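/- All graphs are finite, simple, undirected and have at least one vertex. Let $k\ge 1$, let $G_1,\dots,G_k$ be graphs on $n_1,\dots,n_k$ vertices, and let $G=G_1\boxtimes\cdots\boxtimes G_k$ be their strong product (distinct tuples are adjacent iff in each coordinate their entries are equal or adjacent). Write $\overline{G}$ for the complement, $\chi$ for the chromatic number, $\omega$ for the clique number and $\lambda_{\min}$ for the smallest adjacency eigenvalue. Let $\theta$ be the Lovász function, $$\theta(H)=\min_{u,c}\ \max_{i\in V(H)}\frac{1}{(c^{\mathsf T}u_i)^2},$$ where $u$ ranges over all assignments of unit vectors $u_i\in\mathbb R^m$ ($m$ arbitrary) to the vertices of $H$ such that $u_i\perp u_j$ whenever $i\neq j$ are non-adjacent, $c$ ranges over all unit vectors in $\mathbb R^m$, and $1/0=+\infty$. A $d$-regular graph is strongly regular if there are integers $\lambda,\mu\ge 0$ such that any two adjacent vertices have exactly $\lambda$ common neighbours and any two distinct non-adjacent vertices have exactly $\mu$. Then the following hold. (a) $$\chi(G)\ \ge\ \Big\lceil \prod_{\ell=1}^k \frac{n_\ell}{\theta(G_\ell)}\Big\rceil,\qquad \chi(\overline{G})\ \ge\ \Big\lceil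 \prod_{\ell=1}^k \theta(G_\ell)\Big\rceil .$$ (b) If each $G_\ell$ is $d_\ell$-regular, then $\chi(G)\ge \big\lceil \prod_{\ell} n_\ell/\theta(G_\ell)\big\rceil$, and if moreover each $G_\ell$ has at least one edge, then $$\Big\lceil \prod_{\ell=1}^k \frac{n_\ell}{\theta(G_\ell)}\Big\rceil\ \ge\ \Big\lceil \prod_{\ell=1}^k \Big(1-\frac{d_\ell}{\lambda_{\min}(G_\ell)}\Big)\Big\rceil ,$$ with equality if each $G_\ell$ is edge-transitive or strongly regular. (c) If each $G_\ell$ is $d_\ell$-regular with at least one edge, and is edge-transitive or strongly regular, then $G$ is regular of valency $d(G)=\prod_{\ell=1}^k(1+d_\ell)-1$ and $$\prod_{\ell=1}^k \Big(1-\frac{d_\ell}{\lambda_{\min}(G_\ell)}\Big)\ \ge\ 1-\frac{d(G)}{\lambda_{\min}(G)} .$$ (d) (1) If each $G_\ell$ is vertex-transitive or strongly regular, then $\big\lceil \prod_{\ell} n_\ell/\theta(G_\ell)\big\rceil\ge\prod_{\ell}\omega(G_\ell)$. (2) If each $G_\ell$ is $d_\ell$-regular with at least one edge, and is either both vertex-transitive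 and edge-transitive, or strongly regular, then $\big\lceil \prod_{\ell} (1-d_\ell/\lambda_{\min}(G_\ell))\big\rceil\ge\prod_{\ell}\omega(G_\ell)$. (e) If each $G_\ell$ is $d_\ell$-regular with at least one edge, and is edge-transitive or strongly regular, then $$\chi(\overline{G})\ \ge\ \Big\lceil \prod_{\ell=1}^k \Big(-\frac{n_\ell\,\lambda_{\min}(G_\ell)}{d_\ell-\lambda_{\min}(G_\ell)}\Big)\Big\rceil .$$ (f) If each $G_\ell$ is self-complementary, and is vertex-transitive or strongly regular, then with $n=\prod_{\ell=1}^k n_\ell$, $$\chi(G)\ge\lceil\sqrt n\,\rceil,\qquad \chi(\overline{G})\ge\lceil\sqrt n\,\rceil .$$ -/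

import Mathlib

namespace SimpleGraph

/-- The strong product `G ⊠ H` of two graphs: distinct vertices are adjacent iff in each
coordinate they are equal or adjacent. -/
def strongProduct {V W : Type*} (G : SimpleGraph V) (H : SimpleGraph W) :
    SimpleGraph (V × W) where
  Adj u v := (u.1 = v.1 ∧ H.Adj u.2 v.2) ∨ (G.Adj u.1 v.1 ∧ u.2 = v.2) ∨
    (G.Adj u.1 v.1 ∧ H.Adj u.2 v.2)
  symm := ⟨fun u v h => by
    rcases h with h | h | h
    · exact Or.inl ⟨h.1.symm, h.2.symm⟩
    · exact Or.inr (Or.inl ⟨h.1.symm, h.2.symm⟩)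
    · exact Or.inr (Or.inr ⟨h.1.symm, h.2.symm⟩)⟩
  loopless := ⟨fun u h => by
    rcases h with h | h | h
    · exact H.loopless.irrefl _ h.2
    · exact G.loopless.irrefl _ h.1
    · exact G.loopless.irrefl _ h.1⟩

/-- The strong product `G₁ ⊠ ⋯ ⊠ G_k` of a family of graphs: distinct tuples are adjacent iff in
each coordinate they are equal or adjacent. -/
def strongProductFamily {ι : Type*} {V : ι → Type*} (G : ∀ i, SimpleGraph (V i)) :
    SimpleGraph (∀ i, V i) where
  Adj u v := u ≠ v ∧ ∀ i, u i = v i ∨ (G i).Adj (u i) (v i)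
  symm := ⟨fun _ _ h => ⟨h.1.symm, fun i => (h.2 i).imp Eq.symm Adj.symm⟩⟩
  loopless := ⟨fun _ h => h.1 rfl⟩

instance strongProductFamily.instDecidableRelAdj {ι : Type*} [Fintype ι] {V : ι → Type*} [∀ i, DecidableEq (V i)]
    (G : ∀ i, SimpleGraph (V i)) [∀ i, DecidableRel (G i).Adj] :
    DecidableRel (strongProductFamily G).Adj :=
  fun u v => inferInstanceAs (Decidable (u ≠ v ∧ ∀ i, u i = v i ∨ (G i).Adj (u i) (v i)))

/-- The product of a family indexed by `Fin (k + 1)` is the binary strong product of the first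
factor with the product of the others, so the product of a family is the iterated binary one. -/
theorem strongProductFamily_succ {k : ℕ} {V : Fin (k + 1) → Type*}
    (G : ∀ i, SimpleGraph (V i)) :
    Nonempty (strongProductFamily G ≃g
      strongProduct (G 0) (strongProductFamily fun i : Fin k => G i.succ)) := by
  refine ⟨⟨(Fin.consEquiv V).symm, ?_⟩⟩
  intro u v
  have h : u = v ↔ u 0 = v 0 ∧ (fun i : Fin k => u i.succ) = fun i : Fin k => v i.succ := by
    constructor
    · rintro rfl
      exact ⟨rfl, rfl⟩
    · rintro ⟨h0, hs⟩
      funext i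
      exact Fin.cases h0 (fun j => congrFun hs j) i
  have hne : (G 0).Adj (u 0) (v 0) → u 0 ≠ v 0 := fun h => h.ne
  have hs : (fun i : Fin k => u i.succ) = (fun i : Fin k => v i.succ) → ∀ i : Fin k,
      u i.succ = v i.succ ∨ (G i.succ).Adj (u i.succ) (v i.succ) :=
    fun h i => Or.inl (congrFun h i)
  change (strongProduct (G 0) (strongProductFamily fun i : Fin k => G i.succ)).Adj
    (u 0, fun i => u i.succ) (v 0, fun i => v i.succ) ↔ _
  simp only [strongProduct, strongProductFamily, Fin.forall_fin_succ, ne_eq]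
  rw [h]
  tauto

/-- An orthonormal representation of `G` in `ℝᵐ`: unit vectors, with the vectors of distinct
non-adjacent vertices orthogonal. -/
def IsOrthonormalRepresentation {V : Type*} (G : SimpleGraph V) {m : ℕ}
    (u : V → EuclideanSpace ℝ (Fin m)) : Prop :=
  (∀ i, ‖u i‖ = 1) ∧ ∀ i j, i ≠ j → ¬ G.Adj i j → inner ℝ (u i) (u j) = 0

/-- The Lovász function `θ(G)`: the infimum, over all orthonormal representations `u` of `G` in
some `ℝᵐ` and all unit vectors `c`, of `max_i 1 / ⟨c, u i⟩²`. A pair with `⟨c, u i⟩ = 0` for some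
`i`, where the maximum is `+∞`, does not contribute. -/
noncomputable def lovaszTheta {V : Type*} (G : SimpleGraph V) : ℝ :=
  sInf {t : ℝ | ∃ (m : ℕ) (u : V → EuclideanSpace ℝ (Fin m)) (c : EuclideanSpace ℝ (Fin m)),
    G.IsOrthonormalRepresentation u ∧ ‖c‖ = 1 ∧ (∀ i, inner ℝ c (u i) ≠ 0) ∧
      t = ⨆ i, 1 / (inner ℝ c (u i)) ^ 2}

/-- The smallest eigenvalue of the adjacency matrix of `G`. -/
noncomputable def minEigenvalue {V : Type*} [Fintype V] [DecidableEq V] (G : SimpleGraph V)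
    [DecidableRel G.Adj] : ℝ :=
  sInf (spectrum ℝ (G.adjMatrix ℝ))

/-- Any two vertices are exchanged by some automorphism. -/
def IsVertexTransitive {V : Type*} (G : SimpleGraph V) : Prop :=
  ∀ u v : V, ∃ f : G ≃g G, f u = v

/-- Any edge is mapped to any other edge (as unordered pairs) by some automorphism. -/
def IsEdgeTransitive {V : Type*} (G : SimpleGraph V) : Prop :=
  ∀ e₁ ∈ G.edgeSet, ∀ e₂ ∈ G.edgeSet, ∃ f : G ≃g G, e₁.map f = e₂

/-- `G` is strongly regular for some parameters. -/
def IsStronglyRegular {V : Type*} [Fintype V] (G : SimpleGraph V) [DecidableRel G.Adj] : Prop :=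
  ∃ d l m : ℕ, G.IsSRGWith (Fintype.card V) d l m

/-- `G` is isomorphic to its complement. -/
def IsSelfComplementary {V : Type*} (G : SimpleGraph V) : Prop :=
  Nonempty (G ≃g Gᶜ)

end SimpleGraph

/-! Everything rests on two semidefinite descriptions of θ. Write J for the all-ones matrix. A
primal certificate is a matrix M with M - J positive semidefinite, diagonal at most t, and zeros at
distinct non-adjacent pairs; it corresponds to an orthonormal representation through M i j = ⟨u i, u
j⟩ / (⟨c, u i⟩ ⟨c, u j⟩), since M - J is then the Gram matrix of the vectors u i / ⟨c, u i⟩ - c. A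
dual certificate is a positive semidefinite B vanishing on edges; it bounds θ below by (sum of
entries) / trace. Weak duality is the Schur product theorem, strong duality
(`exists_isThetaDual_of_lt`) is Hahn–Banach separation. Optima are never shown to be attained;
values close to θ and limits suffice.

Tensor products of certificates are certificates for the strong product, so θ is multiplicative
(`lovaszTheta_strongProductFamily`), and the colouring bounds reduce to a single graph: a colouring
of the complement is a primal certificate, a colouring of the graph a dual one.

A dual certificate of H with constant diagonal and constant row sums rescales to a primal
certificate of the complement (`IsThetaDual.lovaszTheta_compl_le`). Applied to A - λ_min I this is
Hoffman's bound on θ. Equality holds once some positive semidefinite E with AE = λ_min E is constant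
and negative on edges: average v vᵀ over automorphisms for an edge-transitive graph, take a
polynomial in A and J for a strongly regular one. Part (c) is Hoffman's bound for the product graph
itself.

If such homogeneous dual certificates approximate θ(G), then θ(G) θ(Gᶜ) ≤ n. With ω(G) ≤ θ(Gᶜ) this
gives the clique bounds; with the general inequality θ(G) θ(Gᶜ) ≥ n it gives θ = √n for
self-complementary graphs. -/

section LovaszTheta

open Matrix Finset

/-! ### Positive semidefinite matrices: Gram form, entrywise and tensor products -/

namespace Matrix

variable {V ι : Type*} [Fintype V] [Fintype ι]

theorem dotProduct_mulVec_eq_sum (M : Matrix V V ℝ) (x : V → ℝ) :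
    x ⬝ᵥ M *ᵥ x = ∑ i, ∑ j, x i * M i j * x j := by
  simp [dotProduct, mulVec, Finset.mul_sum, mul_assoc]

theorem posSemidef_iff_sum {M : Matrix V V ℝ} :
    M.PosSemidef ↔ (∀ i j, M i j = M j i) ∧ ∀ x : V → ℝ, 0 ≤ ∑ i, ∑ j, x i * M i j * x j := by
  rw [posSemidef_iff_dotProduct_mulVec]
  simp only [star_trivial, dotProduct_mulVec_eq_sum]
  refine and_congr_left fun _ => ⟨fun h i j => ?_, fun h => ?_⟩
  · simpa using h.apply j i
  · ext i j
    simpa using h j i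

theorem PosSemidef.exists_gram {M : Matrix V V ℝ} (hM : M.PosSemidef) :
    ∃ (m : ℕ) (x : V → Fin m → ℝ), ∀ i j, M i j = ∑ k, x i k * x j k := by
  obtain ⟨m, v, hv⟩ := posSemidef_iff_eq_sum_vecMulVec.mp hM
  refine ⟨m, fun i k => v k i, fun i j => ?_⟩
  rw [hv, Matrix.sum_apply]
  simp [vecMulVec_apply]

/-- A Gram matrix is positive semidefinite. -/
theorem posSemidef_of_sum_mul (x : V → ι → ℝ) :
    (of fun i j => ∑ k, x i k * x j k : Matrix V V ℝ).PosSemidef := by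
  rw [posSemidef_iff_sum]
  refine ⟨fun i j => by simp [mul_comm], fun y => ?_⟩
  have : ∑ i, ∑ j, y i * (of fun i j => ∑ k, x i k * x j k : Matrix V V ℝ) i j * y j
      = ∑ k, (∑ i, y i * x i k) ^ 2 := by
    simp_rw [of_apply, sq, Finset.sum_mul_sum, Finset.mul_sum, Finset.sum_mul]
    rw [Finset.sum_comm' (t' := univ) (s' := fun _ => univ) (by simp)]
    conv_rhs => rw [Finset.sum_comm]
    rw [Finset.sum_comm]
    refine Finset.sum_congr rfl fun i _ => ?_
    rw [Finset.sum_comm]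
    refine Finset.sum_congr rfl fun j _ => Finset.sum_congr rfl fun k _ => by ring
  rw [this]
  positivity

theorem PosSemidef.mul_entries {κ : Type*} {A B : Matrix κ κ ℝ} (hA : A.PosSemidef)
    (hB : B.PosSemidef) : (of fun i j => A i j * B i j : Matrix κ κ ℝ).PosSemidef :=
  hA.hadamard hB

theorem PosSemidef.sum_mul_nonneg {A B : Matrix V V ℝ} (hA : A.PosSemidef) (hB : B.PosSemidef) :
    0 ≤ ∑ i, ∑ j, A i j * B i j := by
  simpa using (posSemidef_iff_sum.1 (hA.mul_entries hB)).2 fun _ => 1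

/-- Induction on ab - 1 = (a - 1)(b - 1) + (a - 1) + (b - 1) and the Schur product theorem. This is
what makes primal certificates multiply. -/
theorem posSemidef_prod_sub_one {κ : Type*} {V : κ → Type*} [DecidableEq κ] [∀ l, Fintype (V l)]
    {M : ∀ l, Matrix (V l) (V l) ℝ} (hM : ∀ l, (M l - of fun _ _ => 1).PosSemidef)
    (s : Finset κ) :
    (of fun x y : ∀ l, V l => ∏ l ∈ s, M l (x l) (y l) - 1 : Matrix _ _ ℝ).PosSemidef := by
  induction s using Finset.induction_on with
  | empty =>
    convert PosSemidef.zero using 1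
    ext
    simp
  | insert a s ha ih =>
    have h1 := (hM a).submatrix fun x : ∀ l, V l => x a
    have h2 := (h1.mul_entries ih).add (h1.add ih)
    convert h2 using 1
    ext x y
    simp only [of_apply, Finset.prod_insert ha, add_apply, submatrix_apply,
      sub_apply]
    ring

theorem posSemidef_prod {κ : Type*} {V : κ → Type*} [DecidableEq κ] [∀ l, Fintype (V l)]
    {M : ∀ l, Matrix (V l) (V l) ℝ} (hM : ∀ l, (M l).PosSemidef) (s : Finset κ) :
    (of fun x y : ∀ l, V l => ∏ l ∈ s, M l (x l) (y l) : Matrix _ _ ℝ).PosSemidef := by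
  induction s using Finset.induction_on with
  | empty =>
    refine ⟨by ext; simp, fun x => ?_⟩
    simp only [star_trivial, Finset.prod_empty, of_apply, mul_one, Finsupp.sum, ← Finset.mul_sum,
      ← Finset.sum_mul]
    exact mul_self_nonneg _
  | insert a s ha ih =>
    have h1 := (hM a).submatrix fun x : ∀ l, V l => x a
    convert h1.mul_entries ih using 1
    ext x y
    simp [Finset.prod_insert ha]

end Matrix

/-! ### Primal and dual certificates for θ; weak duality -/

namespace SimpleGraph

variable {V : Type*} [Fintype V]

/-- `M` certifies that the Lovász function of `G` is at most `t`. -/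
structure IsThetaPrimal (G : SimpleGraph V) (t : ℝ) (M : Matrix V V ℝ) : Prop where
  posSemidef : (M - of fun _ _ => 1).PosSemidef
  diag_le : ∀ i, M i i ≤ t
  eq_zero : ∀ i j, i ≠ j → ¬ G.Adj i j → M i j = 0

/-- `B` certifies that the Lovász function of `G` is at least `(∑ i j, B i j) / trace B`. -/
structure IsThetaDual (G : SimpleGraph V) (B : Matrix V V ℝ) : Prop where
  posSemidef : B.PosSemidef
  eq_zero : ∀ i j, G.Adj i j → B i j = 0

/-- The set whose infimum is `lovaszTheta G`. -/
def thetaValues (G : SimpleGraph V) : Set ℝ :=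
  {t : ℝ | ∃ (m : ℕ) (u : V → EuclideanSpace ℝ (Fin m)) (c : EuclideanSpace ℝ (Fin m)),
    G.IsOrthonormalRepresentation u ∧ ‖c‖ = 1 ∧ (∀ i, inner ℝ c (u i) ≠ 0) ∧
      t = ⨆ i, 1 / (inner ℝ c (u i)) ^ 2}

variable {G : SimpleGraph V}

/-- Weak duality: pair M - J with B entrywise. Off the diagonal M and B have disjoint supports, so
only the diagonal of M contributes. -/
theorem IsThetaPrimal.sum_le {t : ℝ} {M B : Matrix V V ℝ} (hM : G.IsThetaPrimal t M)
    (hB : G.IsThetaDual B) : ∑ i, ∑ j, B i j ≤ t * B.trace := by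
  have h := hM.posSemidef.sum_mul_nonneg hB.posSemidef
  have h2 : ∀ i, ∑ j, M i j * B i j = M i i * B i i := by
    intro i
    refine Finset.sum_eq_single i (fun j _ hj => ?_) (by simp)
    by_cases hij : G.Adj i j
    · rw [hB.eq_zero i j hij, mul_zero]
    · rw [hM.eq_zero i j hj.symm hij, zero_mul]
  simp only [Matrix.sub_apply, of_apply, sub_mul, one_mul, Finset.sum_sub_distrib, h2] at h
  have h3 : ∑ i, M i i * B i i ≤ t * B.trace := by
    rw [trace, Finset.mul_sum]
    exact Finset.sum_le_sum fun i _ =>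
      mul_le_mul_of_nonneg_right (hM.diag_le i) hB.posSemidef.diag_nonneg
  linarith

theorem exists_isThetaPrimal_of_mem_thetaValues {t : ℝ} (ht : t ∈ G.thetaValues) :
    ∃ M, G.IsThetaPrimal t M := by
  obtain ⟨m, u, c, ⟨hu1, hu2⟩, hc, hcu, rfl⟩ := ht
  have hcc : inner ℝ c c = (1 : ℝ) := by rw [real_inner_self_eq_norm_sq, hc]; norm_num
  refine ⟨of fun i j => inner ℝ (u i) (u j) / (inner ℝ c (u i) * inner ℝ c (u j)), ?_, ?_, ?_⟩
  · convert posSemidef_of_sum_mul fun i => ((inner ℝ c (u i))⁻¹ • u i - c : EuclideanSpace ℝ (Fin m))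
      using 1
    ext i j
    have h : inner ℝ ((inner ℝ c (u i))⁻¹ • u i - c) ((inner ℝ c (u j))⁻¹ • u j - c)
        = inner ℝ (u i) (u j) / (inner ℝ c (u i) * inner ℝ c (u j)) - 1 := by
      simp only [inner_sub_left, inner_sub_right, real_inner_smul_left, real_inner_smul_right, hcc,
        real_inner_comm c (u i)]
      field_simp [hcu i, hcu j]
      ring
    simp only [Matrix.sub_apply, of_apply]
    rw [← h, PiLp.inner_apply]
    simp [mul_comm]
  · intro i
    have h : of (fun i j => inner ℝ (u i) (u j) / (inner ℝ c (u i) * inner ℝ c (u j))) i i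
        = 1 / inner ℝ c (u i) ^ 2 := by
      simp [hu1, sq]
    rw [h]
    exact le_ciSup (f := fun i => 1 / inner ℝ c (u i) ^ 2) (Set.finite_range _).bddAbove i
  · intro i j hij h
    simp [hu2 i j hij h]

theorem IsThetaPrimal.exists_mem_thetaValues [Nonempty V] {t : ℝ} {M : Matrix V V ℝ}
    (hM : G.IsThetaPrimal t M) : ∃ s ∈ G.thetaValues, s ≤ t := by
  obtain ⟨m, x, hx⟩ := hM.posSemidef.exists_gram
  have hx' : ∀ i j, M i j = 1 + ∑ k, x i k * x j k := by
    intro i j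
    have := hx i j
    simp only [Matrix.sub_apply, of_apply] at this
    linarith
  have hpos : ∀ i, 0 < M i i := by
    intro i
    rw [hx']
    have : 0 ≤ ∑ k, x i k * x i k := Finset.sum_nonneg fun k _ => mul_self_nonneg _
    linarith
  -- A leading coordinate 1 adds 1 to every inner product, turning the Gram matrix M - J into M.
  -- With c the new basis vector, ⟨c, w i⟩ = 1, so after normalising w i the value at i is exactly M
  -- i i.
  let w : V → EuclideanSpace ℝ (Fin (m + 1)) := fun i => WithLp.toLp 2 (Fin.cons 1 (x i))
  let c : EuclideanSpace ℝ (Fin (m + 1)) := WithLp.toLp 2 (Fin.cons 1 0)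
  have hw : ∀ i j, inner ℝ (w i) (w j) = M i j := by
    intro i j
    rw [hx', PiLp.inner_apply, Fin.sum_univ_succ]
    simp [w, mul_comm]
  have hcw : ∀ i, inner ℝ c (w i) = (1 : ℝ) := by
    intro i
    rw [PiLp.inner_apply, Fin.sum_univ_succ]
    simp [w, c]
  have hcu : ∀ i, inner ℝ c ((√(M i i))⁻¹ • w i) = (√(M i i))⁻¹ := by
    intro i
    rw [real_inner_smul_right, hcw, mul_one]
  refine ⟨_, ⟨m + 1, fun i => (√(M i i))⁻¹ • w i, c, ⟨fun i => ?_, fun i j hij h => ?_⟩, ?_,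
    fun i => ?_, rfl⟩, ciSup_le fun i => ?_⟩
  · rw [norm_smul, norm_eq_sqrt_real_inner (w i), hw, norm_inv, Real.norm_of_nonneg (Real.sqrt_nonneg _),
      inv_mul_cancel₀ (Real.sqrt_ne_zero'.2 (hpos i))]
  · rw [real_inner_smul_left, real_inner_smul_right, hw, hM.eq_zero i j hij h]
    simp
  · rw [norm_eq_sqrt_real_inner, PiLp.inner_apply, Fin.sum_univ_succ]
    simp [c]
  · rw [hcu]
    exact inv_ne_zero (Real.sqrt_ne_zero'.2 (hpos i))
  · rw [hcu, inv_pow, Real.sq_sqrt (hpos i).le, one_div, inv_inv]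
    exact hM.diag_le i

theorem isThetaDual_single [DecidableEq V] (v : V) :
    G.IsThetaDual (of fun i j => if i = v ∧ j = v then 1 else 0) := by
  refine ⟨?_, fun i j h => ?_⟩
  · convert posSemidef_of_sum_mul fun (i : V) (_ : Unit) => if i = v then (1 : ℝ) else 0 using 1
    ext i j
    by_cases hj : j = v <;> simp [hj]
  · rw [of_apply, if_neg]
    rintro ⟨rfl, rfl⟩
    exact G.loopless.irrefl _ h

theorem one_le_of_mem_thetaValues [Nonempty V] {t : ℝ} (ht : t ∈ G.thetaValues) : 1 ≤ t := by
  classical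
  obtain ⟨M, hM⟩ := exists_isThetaPrimal_of_mem_thetaValues ht
  obtain ⟨v⟩ := ‹Nonempty V›
  simpa [trace, ite_and] using hM.sum_le (isThetaDual_single v)

theorem bddBelow_thetaValues [Nonempty V] : BddBelow G.thetaValues :=
  ⟨1, fun _ ht => one_le_of_mem_thetaValues ht⟩

/-- With S a the sum of x over colour class a, the form of M - J at x is m ∑ (S a)² - (∑ S a)²,
nonnegative by Cauchy–Schwarz. -/
theorem isThetaPrimal_of_coloring_compl {m : ℕ} (C : Gᶜ.Coloring (Fin m)) :
    G.IsThetaPrimal m (of fun i j => if C i = C j then (m : ℝ) else 0) := by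
  refine ⟨?_, fun i => by simp, fun i j hij h => ?_⟩
  · rw [posSemidef_iff_sum]
    refine ⟨fun i j => by simp [eq_comm], fun x => ?_⟩
    have h1 : ∑ i, ∑ j, x i * (of (fun i j => if C i = C j then (m : ℝ) else 0) -
        of fun _ _ => 1 : Matrix V V ℝ) i j * x j
        = m * ∑ a, (∑ i, if C i = a then x i else 0) ^ 2
          - (∑ a, ∑ i, if C i = a then x i else 0) ^ 2 := by
      have h2 : ∑ a, ∑ i, (if C i = a then x i else 0) = ∑ i, x i := by
        rw [Finset.sum_comm]
        simp
      rw [h2]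
      simp_rw [sq, Finset.sum_mul_sum, Finset.mul_sum]
      rw [Finset.sum_comm (s := (univ : Finset (Fin m)))]
      rw [← Finset.sum_sub_distrib]
      refine Finset.sum_congr rfl fun i _ => ?_
      rw [Finset.sum_comm (s := (univ : Finset (Fin m))), ← Finset.sum_sub_distrib]
      refine Finset.sum_congr rfl fun j _ => ?_
      by_cases hij : C i = C j
      · simp [hij]; ring
      · simp [hij]
    rw [h1, sub_nonneg]
    simpa using sq_sum_le_card_mul_sum_sq (s := (univ : Finset (Fin m)))
      (f := fun a => ∑ i, if C i = a then x i else 0)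
  · simp [C.valid ((G.compl_adj i j).2 ⟨hij, h⟩)]

theorem isThetaDual_of_coloring {m : ℕ} (C : G.Coloring (Fin m)) :
    G.IsThetaDual (of fun i j => if C i = C j then (1 : ℝ) else 0) := by
  refine ⟨?_, fun i j h => by simp [C.valid h]⟩
  convert posSemidef_of_sum_mul fun (i : V) (a : Fin m) => if C i = a then (1 : ℝ) else 0 using 1
  ext i j
  simp [eq_comm]

theorem isThetaDual_of_isClique [DecidableEq V] {s : Finset V} (hs : Gᶜ.IsClique s) :
    G.IsThetaDual (of fun i j => if i ∈ s ∧ j ∈ s then (1 : ℝ) else 0) := by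
  refine ⟨?_, fun i j h => ?_⟩
  · convert posSemidef_of_sum_mul fun (i : V) (_ : Unit) => if i ∈ s then (1 : ℝ) else 0 using 1
    ext i j
    by_cases hj : j ∈ s <;> simp [hj]
  · rw [of_apply, if_neg]
    rintro ⟨hi, hj⟩
    exact ((G.compl_adj i j).1 (hs hi hj h.ne)).2 h

theorem thetaValues_nonempty [Nonempty V] : G.thetaValues.Nonempty := by
  obtain ⟨C⟩ := Gᶜ.colorable_of_fintype
  obtain ⟨s, hs, -⟩ := (isThetaPrimal_of_coloring_compl C).exists_mem_thetaValues
  exact ⟨s, hs⟩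

theorem IsThetaPrimal.lovaszTheta_le [Nonempty V] {t : ℝ} {M : Matrix V V ℝ}
    (hM : G.IsThetaPrimal t M) : G.lovaszTheta ≤ t := by
  obtain ⟨s, hs, hst⟩ := hM.exists_mem_thetaValues
  exact (csInf_le bddBelow_thetaValues hs).trans hst

theorem exists_isThetaPrimal_of_lt [Nonempty V] {t : ℝ} (ht : G.lovaszTheta < t) :
    ∃ M, G.IsThetaPrimal t M := by
  obtain ⟨s, hs, hst⟩ := exists_lt_of_csInf_lt (s := G.thetaValues) thetaValues_nonempty ht
  obtain ⟨M, hM⟩ := exists_isThetaPrimal_of_mem_thetaValues hs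
  exact ⟨M, hM.posSemidef, fun i => (hM.diag_le i).trans hst.le, hM.eq_zero⟩

theorem one_le_lovaszTheta [Nonempty V] : 1 ≤ G.lovaszTheta :=
  le_csInf (s := G.thetaValues) thetaValues_nonempty fun _ => one_le_of_mem_thetaValues

theorem lovaszTheta_pos [Nonempty V] : 0 < G.lovaszTheta := one_pos.trans_le one_le_lovaszTheta

/-- Weak duality holds for every t above θ; let t decrease to θ. -/
theorem IsThetaDual.sum_le [Nonempty V] {B : Matrix V V ℝ} (hB : G.IsThetaDual B) :
    ∑ i, ∑ j, B i j ≤ G.lovaszTheta * B.trace := by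
  refine ge_of_tendsto (x := nhdsWithin G.lovaszTheta (Set.Ioi G.lovaszTheta))
    (f := fun t => t * B.trace) ?_ ?_
  · exact ((continuous_id.mul continuous_const).tendsto _).mono_left nhdsWithin_le_nhds
  · filter_upwards [self_mem_nhdsWithin] with t ht
    obtain ⟨M, hM⟩ := exists_isThetaPrimal_of_lt ht
    exact hM.sum_le hB

end SimpleGraph

/-! ### Strong duality by convex separation -/

namespace Matrix

variable {V : Type*} [Fintype V]

theorem continuous_dotProduct_mulVec :
    Continuous fun z : Matrix V V ℝ × (V → ℝ) => z.2 ⬝ᵥ z.1 *ᵥ z.2 := by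
  simp only [dotProduct_mulVec_eq_sum]
  fun_prop

/-- By homogeneity positivity need only be tested on the unit sphere, whose compactness makes it
stable under small perturbations. -/
theorem isOpen_setOf_forall_dotProduct_mulVec_pos :
    IsOpen {M : Matrix V V ℝ | ∀ x : V → ℝ, x ≠ 0 → 0 < x ⬝ᵥ M *ᵥ x} := by
  rw [isOpen_iff_mem_nhds]
  intro M hM
  have hK := (isCompact_sphere (0 : V → ℝ) 1).eventually_forall_of_forall_eventually (x₀ := M)
    (P := fun N x => 0 < x ⬝ᵥ N *ᵥ x) fun y hy => by
      refine continuous_dotProduct_mulVec.continuousAt.eventually (lt_mem_nhds (hM y ?_))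
      rintro rfl
      simp at hy
  filter_upwards [hK] with N hN x hx
  have hx' : 0 < ‖x‖ := norm_pos_iff.2 hx
  have h := hN (‖x‖⁻¹ • x) (by simp [norm_smul, hx'.ne'])
  rw [mulVec_smul, smul_dotProduct, dotProduct_smul, smul_eq_mul, smul_eq_mul] at h
  exact pos_of_mul_pos_right (pos_of_mul_pos_right h (by positivity)) (by positivity)

end Matrix

namespace SimpleGraph

variable {V : Type*} [Fintype V] {G : SimpleGraph V}

/-- The matrices that become positive definite, as quadratic forms, after changing entries at
edges of `G`. -/
def posDefModuloEdges (G : SimpleGraph V) : Set (Matrix V V ℝ) :=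
  {M | ∃ Z : Matrix V V ℝ, (∀ i j, ¬ G.Adj i j → Z i j = 0) ∧
    ∀ x : V → ℝ, x ≠ 0 → 0 < x ⬝ᵥ (M + Z) *ᵥ x}

theorem isOpen_posDefModuloEdges : IsOpen G.posDefModuloEdges := by
  have h : G.posDefModuloEdges = ⋃ Z ∈ {Z : Matrix V V ℝ | ∀ i j, ¬ G.Adj i j → Z i j = 0},
      (fun M => M + Z) ⁻¹' {M : Matrix V V ℝ | ∀ x : V → ℝ, x ≠ 0 → 0 < x ⬝ᵥ M *ᵥ x} := by
    ext M
    simp [posDefModuloEdges]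
  rw [h]
  exact isOpen_biUnion fun Z _ =>
    isOpen_setOf_forall_dotProduct_mulVec_pos.preimage (by fun_prop)

theorem convex_posDefModuloEdges : Convex ℝ G.posDefModuloEdges := by
  rintro M ⟨Z, hZ, hM⟩ M' ⟨Z', hZ', hM'⟩ a b ha hb hab
  refine ⟨a • Z + b • Z', fun i j h => by simp [hZ i j h, hZ' i j h], fun x hx => ?_⟩
  have h : x ⬝ᵥ (a • M + b • M' + (a • Z + b • Z')) *ᵥ x
      = a * (x ⬝ᵥ (M + Z) *ᵥ x) + b * (x ⬝ᵥ (M' + Z') *ᵥ x) := by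
    simp only [add_mulVec, smul_mulVec, dotProduct_add, dotProduct_smul, smul_eq_mul]
    ring
  rw [h]
  have h1 := hM x hx
  have h2 := hM' x hx
  rcases ha.eq_or_lt with rfl | ha
  · have : b = 1 := by linarith
    simp [this, h2]
  · exact add_pos_of_pos_of_nonneg (mul_pos ha h1) (mul_nonneg hb h2.le)

theorem exists_isThetaPrimal_of_mem [DecidableEq V] {t : ℝ}
    (h : t • (1 : Matrix V V ℝ) - of (fun _ _ => 1) ∈ G.posDefModuloEdges) :
    ∃ M, G.IsThetaPrimal t M := by
  obtain ⟨Z, hZ, hpos⟩ := h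
  -- Z need not be symmetric; symmetrising it leaves the quadratic form unchanged.
  refine ⟨t • 1 + (1 / 2 : ℝ) • (Z + Zᵀ), ?_, fun i => ?_, fun i j hij h => ?_⟩
  · rw [posSemidef_iff_dotProduct_mulVec]
    refine ⟨?_, fun x => ?_⟩
    · ext i j
      simp only [conjTranspose_apply, star_trivial, Matrix.sub_apply, Matrix.add_apply,
        Matrix.smul_apply, transpose_apply, of_apply, one_apply, smul_eq_mul, eq_comm (a := i)]
      ring
    · have h : star x ⬝ᵥ (t • 1 + (1 / 2 : ℝ) • (Z + Zᵀ) - of fun _ _ => 1) *ᵥ x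
          = x ⬝ᵥ (t • (1 : Matrix V V ℝ) - of (fun _ _ => 1) + Z) *ᵥ x := by
        have hT : x ⬝ᵥ Zᵀ *ᵥ x = x ⬝ᵥ Z *ᵥ x := by
          rw [mulVec_transpose, dotProduct_comm, dotProduct_mulVec]
        simp only [star_trivial, add_mulVec, sub_mulVec, smul_mulVec, dotProduct_add,
          dotProduct_sub, dotProduct_smul, smul_eq_mul, hT]
        ring
      rw [h]
      rcases eq_or_ne x 0 with rfl | hx
      · simp
      · exact (hpos x hx).le
  · simp [hZ i i (G.loopless.irrefl i)]
  · simp [hij, hZ i j h, hZ j i (fun h' => h h'.symm)]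

/-- Strong duality for the Lovász function. -/
theorem exists_isThetaDual_of_lt [Nonempty V] {s : ℝ} (hs : s < G.lovaszTheta) :
    ∃ B, G.IsThetaDual B ∧ 0 < B.trace ∧ s * B.trace ≤ ∑ i, ∑ j, B i j := by
  classical
  have hnot : s • (1 : Matrix V V ℝ) - of (fun _ _ => 1) ∉ G.posDefModuloEdges := fun h => by
    obtain ⟨M, hM⟩ := exists_isThetaPrimal_of_mem h
    exact hs.not_ge hM.lovaszTheta_le
  -- Since s < θ, the matrix sI - J lies outside this open convex set. The coefficients of the
  -- separating functional, symmetrised, form the dual certificate.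
  obtain ⟨f, hf⟩ := geometric_hahn_banach_point_open convex_posDefModuloEdges
    isOpen_posDefModuloEdges hnot
  set M₀ : Matrix V V ℝ := s • (1 : Matrix V V ℝ) - of (fun _ _ => 1) with hM₀
  have hself : ∀ x : V → ℝ, x ≠ 0 → 0 < x ⬝ᵥ x := fun x hx =>
    (Finset.sum_nonneg fun i _ => mul_self_nonneg (x i)).lt_of_ne' fun h => hx (dotProduct_self_eq_zero.1 h)
  have hfM : ∀ M : Matrix V V ℝ, f M = ∑ i, ∑ j, M i j * f (Matrix.single i j 1) := by
    intro M
    conv_lhs => rw [matrix_eq_sum_single M]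
    simp only [map_sum]
    refine Finset.sum_congr rfl fun i _ => Finset.sum_congr rfl fun j _ => ?_
    rw [← smul_eq_mul, ← map_smul, smul_single, smul_eq_mul, mul_one]
  -- An affine function of c bounded below on [0, ∞) has nonnegative slope; all sign information on
  -- f comes from this.
  have hf0 : ∀ a b : ℝ, (∀ c : ℝ, 0 ≤ c → a < b * c + f 1) → 0 ≤ b := by
    intro a b h
    by_contra! hb
    have := h ((|f 1 - a|) / (-b)) (div_nonneg (abs_nonneg _) (by linarith))
    have h2 : b * ((|f 1 - a|) / (-b)) = -|f 1 - a| := by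
      have := hb.ne
      field_simp
    linarith [le_abs_self (f 1 - a)]
  -- Edge entries may be changed by any real c, of either sign, without leaving the set, so f must
  -- ignore them.
  have hedge : ∀ i j, G.Adj i j → f (Matrix.single i j 1) = 0 := by
    intro i j hij
    have key : ∀ c : ℝ, f M₀ < f (Matrix.single i j 1) * c + f 1 := by
      intro c
      have := hf (c • Matrix.single i j 1 + 1) ⟨-(c • Matrix.single i j 1), fun a b hab => ?_,
        fun x hx => ?_⟩
      · rwa [map_add, map_smul, smul_eq_mul, mul_comm] at this
      · have : ¬ (i = a ∧ j = b) := by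
          rintro ⟨rfl, rfl⟩
          exact hab hij
        simp [single_apply_of_ne _ _ _ _ _ this]
      · rw [add_neg_cancel_comm, one_mulVec]
        exact hself x hx
    refine le_antisymm ?_ (hf0 _ _ fun c _ => key c)
    have := hf0 (f M₀) (-f (Matrix.single i j 1)) fun c _ => by linarith [key (-c)]
    linarith
  have hmem : ∀ M : Matrix V V ℝ, (∀ x : V → ℝ, x ≠ 0 → 0 < x ⬝ᵥ M *ᵥ x) → f M₀ < f M :=
    fun M hM => hf M ⟨0, by simp, by simpa using hM⟩
  have hpsd : ∀ x : V → ℝ, 0 ≤ ∑ i, ∑ j, x i * x j * f (Matrix.single i j 1) := by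
    intro x
    have h1 : f (vecMulVec x x) = ∑ i, ∑ j, x i * x j * f (Matrix.single i j 1) := by
      rw [hfM]
      simp [vecMulVec_apply]
    rw [← h1]
    refine hf0 (f M₀) _ fun c hc => ?_
    have := hmem (c • vecMulVec x x + 1) fun y hy => ?_
    · rwa [map_add, map_smul, smul_eq_mul, mul_comm] at this
    · rw [add_mulVec, smul_mulVec, one_mulVec, dotProduct_add, dotProduct_smul, vecMulVec_mulVec]
      refine add_pos_of_nonneg_of_pos ?_ (hself y hy)
      simp only [op_smul_eq_smul, dotProduct_smul, smul_eq_mul]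
      rw [dotProduct_comm x y]
      exact mul_nonneg hc (mul_self_nonneg _)
  have htr : f 1 = ∑ i, f (Matrix.single i i 1) := by
    rw [hfM]
    simp [one_apply]
  -- All multiples εI with ε > 0 lie in the set, so f M₀ < ε f 1. This sign later becomes the
  -- inequality between s times the trace and the sum of entries.
  have hle : f M₀ ≤ 0 := by
    by_contra! h0
    have h1 : ∀ ε : ℝ, 0 < ε → f M₀ < ε * f 1 := by
      intro ε hε
      rw [← smul_eq_mul, ← map_smul]
      refine hmem _ fun x hx => ?_
      rw [smul_mulVec, one_mulVec, dotProduct_smul]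
      exact mul_pos hε (hself x hx)
    have h2 : 0 < f 1 := by simpa using h0.trans (h1 1 one_pos)
    have h3 := h1 (f M₀ / f 1) (by positivity)
    rw [div_mul_cancel₀ _ h2.ne'] at h3
    exact lt_irrefl _ h3
  have htrpos : 0 < f 1 := by
    -- K makes s + K exceed the number of vertices, so that (s + K)I - J is positive definite; then
    -- f M₀ < f M₀ + K f 1.
    set K : ℝ := Fintype.card V + 1 + |s| with hK
    have h1 := hmem (M₀ + K • 1) fun x hx => ?_
    · rw [map_add, map_smul, smul_eq_mul] at h1
      have : 0 < K := by positivity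
      exact pos_of_mul_pos_right (by linarith) this.le
    · have h2 : x ⬝ᵥ (M₀ + K • 1) *ᵥ x = (s + K) * (x ⬝ᵥ x) - (∑ i, x i) ^ 2 := by
        have h3 : x ⬝ᵥ (of (fun _ _ => 1) : Matrix V V ℝ) *ᵥ x = (∑ i, x i) ^ 2 := by
          rw [dotProduct_mulVec_eq_sum, sq, Finset.sum_mul_sum]
          simp
        rw [hM₀, add_mulVec, sub_mulVec, smul_mulVec, smul_mulVec, one_mulVec, dotProduct_add,
          dotProduct_sub, dotProduct_smul, dotProduct_smul, h3, smul_eq_mul, smul_eq_mul]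
        ring
      rw [h2, sub_pos]
      have h4 : (∑ i, x i) ^ 2 ≤ Fintype.card V * (x ⬝ᵥ x) := by
        simpa [dotProduct, sq] using sq_sum_le_card_mul_sum_sq (s := (univ : Finset V)) (f := x)
      refine h4.trans_lt (mul_lt_mul_of_pos_right ?_ (hself x hx))
      linarith [neg_abs_le s]
  refine ⟨of fun i j => (f (Matrix.single i j 1) + f (Matrix.single j i 1)) / 2,
    ⟨?_, fun i j h => ?_⟩, ?_, ?_⟩
  · rw [posSemidef_iff_sum]
    refine ⟨fun i j => by simp [add_comm], fun x => ?_⟩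
    have h1 := hpsd x
    have h2 : ∑ i, ∑ j, x i * x j * f (Matrix.single j i 1)
        = ∑ i, ∑ j, x i * x j * f (Matrix.single i j 1) := by
      rw [Finset.sum_comm]
      simp_rw [mul_comm (x _) (x _)]
    have h3 : ∑ i, ∑ j, x i * (of fun i j => (f (Matrix.single i j 1) +
        f (Matrix.single j i 1)) / 2 : Matrix V V ℝ) i j * x j
        = (∑ i, ∑ j, x i * x j * f (Matrix.single i j 1)
          + ∑ i, ∑ j, x i * x j * f (Matrix.single j i 1)) / 2 := by
      simp_rw [← Finset.sum_add_distrib, Finset.sum_div]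
      refine Finset.sum_congr rfl fun i _ => Finset.sum_congr rfl fun j _ => ?_
      rw [of_apply]
      ring
    rw [h3, h2]
    linarith
  · simp [hedge i j h, hedge j i h.symm]
  · simpa [trace, htr] using htrpos
  · have h1 : f M₀ = s * f 1 - ∑ i, ∑ j, f (Matrix.single i j 1) := by
      rw [hM₀, map_sub, map_smul, smul_eq_mul, hfM (of _)]
      simp
    have h2 : ∑ i, ∑ j, f (Matrix.single j i 1) = ∑ i, ∑ j, f (Matrix.single i j 1) :=
      Finset.sum_comm
    have h3 : (of fun i j => (f (Matrix.single i j 1) + f (Matrix.single j i 1)) / 2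
        : Matrix V V ℝ).trace = f 1 := by
      simp [trace, htr]
    rw [h3]
    simp only [of_apply, ← Finset.sum_div, Finset.sum_add_distrib, h2]
    linarith

end SimpleGraph

/-! ### Multiplicativity of θ over strong products -/

namespace SimpleGraph

theorem natCeil_le_chromaticNumber {V : Type*} {G : SimpleGraph V} {x : ℝ} (h : ∀ m, G.Colorable m → x ≤ m) :
    (⌈x⌉₊ : ℕ∞) ≤ G.chromaticNumber :=
  le_chromaticNumber_iff_colorable.2 fun m hm => Nat.ceil_le.2 (h m hm)

theorem IsThetaPrimal.map_iso {V W : Type*} [Fintype V] [Fintype W]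
    {G : SimpleGraph V} {H : SimpleGraph W} (e : H ≃g G) {t : ℝ}
    {M : Matrix V V ℝ} (hM : G.IsThetaPrimal t M) : H.IsThetaPrimal t (M.submatrix e e) :=
  ⟨hM.posSemidef.submatrix e, fun _ => hM.diag_le _, fun _ _ hij h =>
    hM.eq_zero _ _ (e.injective.ne hij) fun h' => h (e.map_adj_iff.1 h')⟩

section StrongProduct

variable {κ : Type*} [Fintype κ] [DecidableEq κ] {V : κ → Type*} [∀ l, Fintype (V l)]
  {G : ∀ l, SimpleGraph (V l)}

theorem IsThetaPrimal.strongProductFamily {t : κ → ℝ} {M : ∀ l, Matrix (V l) (V l) ℝ}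
    (hM : ∀ l, (G l).IsThetaPrimal (t l) (M l)) :
    (strongProductFamily G).IsThetaPrimal (∏ l, t l) (of fun x y => ∏ l, M l (x l) (y l)) := by
  have hdiag : ∀ l i, 0 ≤ M l i i := by
    intro l i
    have := (hM l).posSemidef.diag_nonneg (i := i)
    simp only [Matrix.sub_apply, of_apply] at this
    linarith
  refine ⟨posSemidef_prod_sub_one (fun l => (hM l).posSemidef) univ, fun x => ?_,
    fun x y hxy h => ?_⟩
  · exact Finset.prod_le_prod (fun l _ => hdiag l _) fun l _ => (hM l).diag_le _
  · have : ∃ l, x l ≠ y l ∧ ¬ (G l).Adj (x l) (y l) := by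
      by_contra! h'
      exact h ⟨hxy, fun l => or_iff_not_imp_left.2 (h' l)⟩
    obtain ⟨l, h1, h2⟩ := this
    exact Finset.prod_eq_zero (mem_univ l) ((hM l).eq_zero _ _ h1 h2)

/-- Adjacent tuples differ in some coordinate and are adjacent there, so one factor vanishes. -/
theorem IsThetaDual.strongProductFamily {B : ∀ l, Matrix (V l) (V l) ℝ}
    (hB : ∀ l, (G l).IsThetaDual (B l)) :
    (strongProductFamily G).IsThetaDual (of fun x y => ∏ l, B l (x l) (y l)) := by
  refine ⟨posSemidef_prod (fun l => (hB l).posSemidef) univ, fun x y h => ?_⟩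
  obtain ⟨l, hl⟩ := Function.ne_iff.1 h.1
  exact Finset.prod_eq_zero (mem_univ l) ((hB l).eq_zero _ _ ((h.2 l).resolve_left hl))

variable [∀ l, Nonempty (V l)]

theorem lovaszTheta_strongProductFamily_le :
    (strongProductFamily G).lovaszTheta ≤ ∏ l, (G l).lovaszTheta := by
  refine ge_of_tendsto (x := nhdsWithin (0 : ℝ) (Set.Ioi 0))
    (f := fun ε => ∏ l, ((G l).lovaszTheta + ε)) ?_ ?_
  · have h : Continuous fun ε : ℝ => ∏ l, ((G l).lovaszTheta + ε) := by fun_prop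
    simpa using (h.tendsto 0).mono_left nhdsWithin_le_nhds
  · filter_upwards [self_mem_nhdsWithin] with ε hε
    choose M hM using fun l => exists_isThetaPrimal_of_lt (lt_add_of_pos_right (G l).lovaszTheta hε)
    exact (IsThetaPrimal.strongProductFamily hM).lovaszTheta_le

theorem prod_lovaszTheta_le :
    ∏ l, (G l).lovaszTheta ≤ (strongProductFamily G).lovaszTheta := by
  -- Taking ε < 1 ≤ θ keeps each factor θ - ε nonnegative, so the factorwise inequalities can be
  -- multiplied.
  refine le_of_tendsto (x := nhdsWithin (0 : ℝ) (Set.Ioo 0 1))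
    (f := fun ε => ∏ l, ((G l).lovaszTheta - ε)) (hx := ?_) ?_ ?_
  · rw [← mem_closure_iff_nhdsWithin_neBot, closure_Ioo zero_ne_one]
    simp
  · have h : Continuous fun ε : ℝ => ∏ l, ((G l).lovaszTheta - ε) := by fun_prop
    simpa using (h.tendsto 0).mono_left nhdsWithin_le_nhds
  · filter_upwards [self_mem_nhdsWithin] with ε hε
    choose B hB hpos hle using
      fun l => exists_isThetaDual_of_lt (sub_lt_self (G l).lovaszTheta hε.1)
    have h := (IsThetaDual.strongProductFamily hB).sum_le
    have htr : (of fun x y : ∀ l, V l => ∏ l, B l (x l) (y l) : Matrix _ _ ℝ).trace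
        = ∏ l, (B l).trace := by
      simp only [trace, diag_apply, of_apply]
      rw [Finset.prod_univ_sum, Fintype.piFinset_univ]
    have hsum : ∑ x : ∀ l, V l, ∑ y : ∀ l, V l,
        (of fun x y : ∀ l, V l => ∏ l, B l (x l) (y l) : Matrix _ _ ℝ) x y
        = ∏ l, ∑ i, ∑ j, B l i j := by
      simp only [of_apply]
      rw [Finset.prod_univ_sum, Fintype.piFinset_univ]
      refine Finset.sum_congr rfl fun x _ => ?_
      rw [Finset.prod_univ_sum, Fintype.piFinset_univ]
    rw [htr, hsum] at h
    have h2 : (∏ l, ((G l).lovaszTheta - ε)) * ∏ l, (B l).trace ≤ ∏ l, ∑ i, ∑ j, B l i j := by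
      rw [← Finset.prod_mul_distrib]
      refine Finset.prod_le_prod (fun l _ => mul_nonneg ?_ (hpos l).le) fun l _ => hle l
      have := one_le_lovaszTheta (G := G l)
      linarith [hε.2]
    exact le_of_mul_le_mul_right (h2.trans h) (Finset.prod_pos fun l _ => hpos l)

/-- The Lovász function is multiplicative for the strong product. -/
theorem lovaszTheta_strongProductFamily :
    (strongProductFamily G).lovaszTheta = ∏ l, (G l).lovaszTheta :=
  lovaszTheta_strongProductFamily_le.antisymm prod_lovaszTheta_le

end StrongProduct

/-! ### Colourings, cliques and complements -/

variable {V : Type*} [Fintype V] [Nonempty V] {G : SimpleGraph V}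

theorem lovaszTheta_le_of_colorable_compl {m : ℕ} (h : Gᶜ.Colorable m) : G.lovaszTheta ≤ m := by
  obtain ⟨C⟩ := h
  exact (isThetaPrimal_of_coloring_compl C).lovaszTheta_le

/-- The certificate of a colouring has trace n and entry sum equal to the sum of the squared class
sizes, at least n² / m by Cauchy–Schwarz. -/
theorem card_div_lovaszTheta_le_of_colorable {m : ℕ} (h : G.Colorable m) :
    Fintype.card V / G.lovaszTheta ≤ m := by
  classical
  obtain ⟨C⟩ := h
  have h1 := (isThetaDual_of_coloring C).sum_le
  have h2 : (Fintype.card V : ℝ) ^ 2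
      ≤ m * ∑ i, ∑ j, (of fun i j => if C i = C j then (1 : ℝ) else 0 : Matrix V V ℝ) i j := by
    have h3 : (Fintype.card V : ℝ) = ∑ a, ∑ i, if C i = a then (1 : ℝ) else 0 := by
      rw [Finset.sum_comm]
      simp
    have h4 : ∑ i, ∑ j, (of fun i j => if C i = C j then (1 : ℝ) else 0 : Matrix V V ℝ) i j
        = ∑ a, (∑ i, if C i = a then (1 : ℝ) else 0) ^ 2 := by
      simp_rw [sq, Finset.sum_mul_sum]
      rw [Finset.sum_comm (s := (univ : Finset (Fin m)))]
      refine Finset.sum_congr rfl fun i _ => ?_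
      rw [Finset.sum_comm (s := (univ : Finset (Fin m)))]
      refine Finset.sum_congr rfl fun j _ => ?_
      simp [eq_comm]
    rw [h3, h4]
    simpa using sq_sum_le_card_mul_sum_sq (s := (univ : Finset (Fin m)))
      (f := fun a => ∑ i, if C i = a then (1 : ℝ) else 0)
  have htr : (of fun i j => if C i = C j then (1 : ℝ) else 0 : Matrix V V ℝ).trace
      = Fintype.card V := by
    simp [trace]
  rw [htr] at h1
  have hn : (0 : ℝ) < Fintype.card V := by exact_mod_cast Fintype.card_pos
  rw [div_le_iff₀ lovaszTheta_pos]
  refine le_of_mul_le_mul_right ?_ hn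
  calc (Fintype.card V : ℝ) * Fintype.card V = (Fintype.card V : ℝ) ^ 2 := (sq _).symm
    _ ≤ _ := h2
    _ ≤ m * (G.lovaszTheta * Fintype.card V) := mul_le_mul_of_nonneg_left h1 (Nat.cast_nonneg m)
    _ = _ := by ring

/-- A maximum clique is independent in the complement; its indicator gives a dual certificate there
with trace ω and entry sum ω². -/
theorem cliqueNum_le_lovaszTheta_compl : (G.cliqueNum : ℝ) ≤ Gᶜ.lovaszTheta := by
  classical
  obtain ⟨s, hs⟩ := G.exists_isNClique_cliqueNum
  have h := (isThetaDual_of_isClique (G := Gᶜ) (s := s) (by rw [compl_compl]; exact hs.1)).sum_le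
  have htr : (of fun i j => if i ∈ s ∧ j ∈ s then (1 : ℝ) else 0 : Matrix V V ℝ).trace
      = G.cliqueNum := by
    simp [trace, hs.2]
  have hsum : ∑ i, ∑ j, (of fun i j => if i ∈ s ∧ j ∈ s then (1 : ℝ) else 0 : Matrix V V ℝ) i j
      = G.cliqueNum * G.cliqueNum := by
    simp [ite_and, ← hs.2]
  rw [htr, hsum] at h
  rcases (Nat.cast_nonneg (α := ℝ) G.cliqueNum).eq_or_lt with h0 | h0
  · rw [← h0]
    exact lovaszTheta_pos.le
  · exact le_of_mul_le_mul_right h h0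

/-- The entrywise product of primal certificates of G and Gᶜ is diagonal, hence a primal certificate
of the edgeless graph; test it against J. -/
theorem card_le_lovaszTheta_mul_lovaszTheta_compl :
    Fintype.card V ≤ G.lovaszTheta * Gᶜ.lovaszTheta := by
  classical
  refine ge_of_tendsto (x := nhdsWithin (0 : ℝ) (Set.Ioi 0))
    (f := fun ε => (G.lovaszTheta + ε) * (Gᶜ.lovaszTheta + ε)) ?_ ?_
  · have h : Continuous fun ε : ℝ => (G.lovaszTheta + ε) * (Gᶜ.lovaszTheta + ε) := by fun_prop
    simpa using (h.tendsto 0).mono_left nhdsWithin_le_nhds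
  filter_upwards [self_mem_nhdsWithin] with ε hε
  obtain ⟨M, hM⟩ := exists_isThetaPrimal_of_lt (lt_add_of_pos_right G.lovaszTheta hε)
  obtain ⟨N, hN⟩ := exists_isThetaPrimal_of_lt (lt_add_of_pos_right Gᶜ.lovaszTheta hε)
  have hMN : (⊤ : SimpleGraph V)ᶜ.IsThetaPrimal ((G.lovaszTheta + ε) * (Gᶜ.lovaszTheta + ε))
      (of fun i j => M i j * N i j) := by
    refine ⟨?_, fun i => ?_, fun i j hij _ => ?_⟩
    · have h := (hM.posSemidef.mul_entries hN.posSemidef).add (hM.posSemidef.add hN.posSemidef)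
      convert h using 1
      ext i j
      simp only [Matrix.sub_apply, of_apply, Matrix.add_apply]
      ring
    · have h1 := hM.posSemidef.diag_nonneg (i := i)
      have h2 := hN.posSemidef.diag_nonneg (i := i)
      simp only [Matrix.sub_apply, of_apply] at h1 h2
      exact mul_le_mul (hM.diag_le i) (hN.diag_le i) (by linarith)
        ((by linarith : 0 ≤ M i i).trans (hM.diag_le i))
    · by_cases h : G.Adj i j
      · simp [hN.eq_zero i j hij fun h' => ((G.compl_adj i j).1 h').2 h]
      · simp [hM.eq_zero i j hij h]
  have hB : (⊤ : SimpleGraph V)ᶜ.IsThetaDual (of fun _ _ => 1) := by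
    refine ⟨?_, fun i j h => by simp at h⟩
    convert posSemidef_of_sum_mul fun (_ : V) (_ : Unit) => (1 : ℝ) using 1
    ext
    simp
  have h := hMN.sum_le hB
  have hn : (0 : ℝ) < Fintype.card V := by exact_mod_cast Fintype.card_pos
  simp only [of_apply, trace, diag_apply, sum_const, card_univ, nsmul_eq_mul, mul_one] at h
  exact le_of_mul_le_mul_right h hn

theorem Iso.lovaszTheta_le {W : Type*} [Fintype W] [Nonempty W] {H : SimpleGraph W}
    (e : H ≃g G) : H.lovaszTheta ≤ G.lovaszTheta := by
  refine le_of_forall_gt_imp_ge_of_dense fun t ht => ?_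
  obtain ⟨M, hM⟩ := exists_isThetaPrimal_of_lt ht
  exact (hM.map_iso e).lovaszTheta_le

theorem IsSelfComplementary.lovaszTheta_compl (h : G.IsSelfComplementary) :
    Gᶜ.lovaszTheta = G.lovaszTheta := by
  obtain ⟨e⟩ := h
  exact (Iso.lovaszTheta_le e.symm).antisymm (Iso.lovaszTheta_le e)

/-- A dual certificate of `G` with constant diagonal and constant row sums yields an upper bound
for the Lovász function of the complement. -/
theorem IsThetaDual.lovaszTheta_compl_le {B : Matrix V V ℝ} (hB : G.IsThetaDual B) {b s : ℝ}
    (hs : 0 < s) (hdiag : ∀ i, B i i = b) (hrow : ∀ i, ∑ j, B i j = s) :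
    Gᶜ.lovaszTheta ≤ Fintype.card V * b / s := by
  classical
  have hn : (0 : ℝ) < Fintype.card V := by exact_mod_cast Fintype.card_pos
  refine IsThetaPrimal.lovaszTheta_le (M := (Fintype.card V / s) • B) ⟨?_, fun i => ?_,
    fun i j hij h => ?_⟩
  · have hsymm := (posSemidef_iff_sum.1 hB.posSemidef).1
    rw [posSemidef_iff_sum]
    refine ⟨fun i j => by simp [hsymm i j], fun x => ?_⟩
    -- Centre x by its mean a. Constant row sums give (x - a)ᵀ B (x - a) = xᵀBx - s n a², and n / s
    -- times this is the form of (n / s)B - J at x.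
    set a : ℝ := (∑ i, x i) / Fintype.card V with ha
    have hx : ∑ i, x i = Fintype.card V * a := by rw [ha]; field_simp
    have h := (posSemidef_iff_sum.1 hB.posSemidef).2 fun i => x i - a
    have h1 : ∑ i, ∑ j, (x i - a) * B i j * (x j - a)
        = ∑ i, ∑ j, x i * B i j * x j - s * Fintype.card V * a ^ 2 := by
      have e1 : ∀ i, ∑ j, (x i - a) * B i j * (x j - a)
          = ∑ j, x i * B i j * x j - a * ∑ j, B i j * x j - a * x i * s + a ^ 2 * s := by
        intro i
        rw [← hrow i, Finset.mul_sum, Finset.mul_sum, Finset.mul_sum, ← Finset.sum_sub_distrib,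
          ← Finset.sum_sub_distrib, ← Finset.sum_add_distrib]
        exact Finset.sum_congr rfl fun j _ => by ring
      have e2 : ∑ i, ∑ j, B i j * x j = s * (Fintype.card V * a) := by
        rw [Finset.sum_comm, ← hx, Finset.mul_sum]
        refine Finset.sum_congr rfl fun j _ => ?_
        rw [← Finset.sum_mul, ← hrow j]
        simp_rw [hsymm _ j]
      simp_rw [e1]
      rw [Finset.sum_add_distrib, Finset.sum_sub_distrib, Finset.sum_sub_distrib,
        ← Finset.mul_sum, e2, ← Finset.sum_mul, ← Finset.mul_sum, hx]
      simp
      ring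
    have h2 : ∑ i, ∑ j, x i * ((Fintype.card V / s) • B - of fun _ _ => 1 : Matrix V V ℝ) i j * x j
        = (Fintype.card V / s) * ∑ i, ∑ j, x i * B i j * x j - (∑ i, x i) ^ 2 := by
      rw [sq, Finset.sum_mul_sum, Finset.mul_sum, ← Finset.sum_sub_distrib]
      refine Finset.sum_congr rfl fun i _ => ?_
      rw [Finset.mul_sum, ← Finset.sum_sub_distrib]
      refine Finset.sum_congr rfl fun j _ => ?_
      simp only [Matrix.sub_apply, Matrix.smul_apply, of_apply, smul_eq_mul]
      ring
    rw [h2, hx]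
    rw [h1] at h
    have h3 := mul_nonneg (div_pos hn hs).le h
    have h4 : (Fintype.card V / s) * (s * Fintype.card V * a ^ 2)
        = (Fintype.card V * a) ^ 2 := by field_simp
    rw [mul_sub, h4] at h3
    exact h3
  · rw [Matrix.smul_apply, hdiag, smul_eq_mul]
    exact le_of_eq (by ring)
  · have : G.Adj i j := by
      by_contra h'
      exact h ((G.compl_adj i j).2 ⟨hij, h'⟩)
    simp [hB.eq_zero i j this]

/-- The dual certificates with constant diagonal and constant row sums of `G` suffice to
approximate its Lovász function. -/
def HasHomogeneousDual (G : SimpleGraph V) : Prop :=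
  ∀ t < G.lovaszTheta, ∃ (B : Matrix V V ℝ) (b s : ℝ), G.IsThetaDual B ∧ 0 < b ∧ t * b ≤ s ∧
    (∀ i, B i i = b) ∧ ∀ i, ∑ j, B i j = s

/-- A homogeneous certificate with s / b ≥ t > 0 gives θ(Gᶜ) ≤ n b / s ≤ n / t. -/
theorem HasHomogeneousDual.mul_le (h : G.HasHomogeneousDual) :
    G.lovaszTheta * Gᶜ.lovaszTheta ≤ Fintype.card V := by
  rw [← le_div_iff₀ lovaszTheta_pos]
  refine le_of_forall_lt_imp_le_of_dense fun t ht => ?_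
  rcases le_or_gt t 0 with h0 | h0
  · exact h0.trans (by have := lovaszTheta_pos (G := Gᶜ); positivity)
  obtain ⟨B, b, s, hB, hb, hle, hdiag, hrow⟩ := h t ht
  have hs : 0 < s := (mul_pos h0 hb).trans_le hle
  rw [le_div_iff₀ lovaszTheta_pos]
  calc t * Gᶜ.lovaszTheta ≤ t * (Fintype.card V * b / s) :=
        mul_le_mul_of_nonneg_left (hB.lovaszTheta_compl_le hs hdiag hrow) h0.le
    _ = Fintype.card V * (t * b / s) := by ring
    _ ≤ Fintype.card V * 1 :=
        mul_le_mul_of_nonneg_left ((div_le_one hs).2 hle) (Nat.cast_nonneg _)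
    _ = _ := mul_one _

end SimpleGraph

/-! ### The least eigenvalue and Hoffman's bound -/

namespace SimpleGraph

variable {V : Type*} [Fintype V] [Nonempty V] [DecidableEq V] {G : SimpleGraph V}
  [DecidableRel G.Adj]

section MinEigenvalue

variable (G) in
theorem minEigenvalue_mem_spectrum : G.minEigenvalue ∈ spectrum ℝ (G.adjMatrix ℝ) := by
  refine Set.Nonempty.csInf_mem ?_ (finite_real_spectrum)
  rw [(isHermitian_adjMatrix ℝ G).spectrum_real_eq_range_eigenvalues]
  exact Set.range_nonempty _

variable (G) in
theorem exists_adjMatrix_mulVec_eq_minEigenvalue_smul :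
    ∃ v : V → ℝ, v ≠ 0 ∧ G.adjMatrix ℝ *ᵥ v = G.minEigenvalue • v := by
  have h := minEigenvalue_mem_spectrum G
  have hA : (G.adjMatrix ℝ).IsHermitian := isHermitian_adjMatrix ℝ G
  rw [hA.spectrum_real_eq_range_eigenvalues] at h
  obtain ⟨i, hi⟩ := h
  refine ⟨hA.eigenvectorBasis i, fun h0 => ?_, by rw [hA.mulVec_eigenvectorBasis, hi]⟩
  exact hA.eigenvectorBasis.orthonormal.ne_zero i (by ext j; exact congrFun h0 j)

variable (G) in
omit [Nonempty V] in
theorem posSemidef_adjMatrix_sub_minEigenvalue :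
    (G.adjMatrix ℝ - G.minEigenvalue • (1 : Matrix V V ℝ)).PosSemidef := by
  refine posSemidef_iff_isHermitian_and_spectrum_nonneg.2
    ⟨(isHermitian_adjMatrix ℝ G).sub (isHermitian_one.smul (IsSelfAdjoint.all _)), ?_⟩
  rw [← Algebra.algebraMap_eq_smul_one, ← spectrum.sub_singleton_eq]
  rintro _ ⟨a, ha, _, rfl, rfl⟩
  exact sub_nonneg.2 (csInf_le (finite_real_spectrum).bddBelow ha)

omit [Nonempty V] in
-- The principal 2 × 2 block of A - λ_min I at an edge, tested on (1, -1), even gives λ_min ≤ -1.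
theorem minEigenvalue_neg (h : G ≠ ⊥) : G.minEigenvalue < 0 := by
  obtain ⟨a, b, hab⟩ := ne_bot_iff_exists_adj.1 h
  have h := (posSemidef_iff_sum.1
    ((posSemidef_adjMatrix_sub_minEigenvalue G).submatrix ![a, b])).2 ![1, -1]
  simp [Fin.sum_univ_two, hab, hab.symm, one_apply, hab.ne, hab.ne.symm] at h
  linarith

end MinEigenvalue

section Regular

variable {d : ℕ}

omit [Nonempty V] [DecidableEq V] in
theorem IsRegularOfDegree.sum_adjMatrix (hd : G.IsRegularOfDegree d) (i : V) :
    ∑ j, G.adjMatrix ℝ i j = d := by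
  simp [adjMatrix_apply, ← hd.degree_eq i, degree, neighborFinset_eq_filter]

theorem IsRegularOfDegree.lovaszTheta_le (hd : G.IsRegularOfDegree d) (h : G ≠ ⊥) :
    G.lovaszTheta ≤ -(Fintype.card V * G.minEigenvalue) / (d - G.minEigenvalue) := by
  have hneg := minEigenvalue_neg h
  have hB : Gᶜ.IsThetaDual (G.adjMatrix ℝ - G.minEigenvalue • (1 : Matrix V V ℝ)) :=
    ⟨posSemidef_adjMatrix_sub_minEigenvalue G, fun i j h => by
      simp [((G.compl_adj i j).1 h).1, ((G.compl_adj i j).1 h).2]⟩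
  have h := hB.lovaszTheta_compl_le (b := -G.minEigenvalue) (s := d - G.minEigenvalue)
    (by linarith [Nat.cast_nonneg (α := ℝ) d]) (fun i => by simp) (fun i => by
      simp only [Matrix.sub_apply, Finset.sum_sub_distrib, hd.sum_adjMatrix]
      simp [one_apply])
  rwa [compl_compl, mul_neg] at h

/-- A positive semidefinite matrix in the eigenspace of the least eigenvalue that takes one
negative value at all edges. -/
structure IsEdgeConstantEigenmatrix (G : SimpleGraph V) [DecidableRel G.Adj] (e : ℝ)
    (E : Matrix V V ℝ) : Prop where
  posSemidef : E.PosSemidef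
  neg : e < 0
  mul_eq : G.adjMatrix ℝ * E = G.minEigenvalue • E
  eq_of_adj : ∀ i j, G.Adj i j → E i j = e

namespace IsEdgeConstantEigenmatrix

variable {e : ℝ} {E : Matrix V V ℝ}

omit [Nonempty V] in
theorem mul_diag_eq (hE : G.IsEdgeConstantEigenmatrix e E) (hd : G.IsRegularOfDegree d) (i : V) :
    G.minEigenvalue * E i i = d * e := by
  have h := congrFun (congrFun hE.mul_eq i) i
  rw [adjMatrix_mul_apply, Matrix.smul_apply, smul_eq_mul] at h
  rw [← h, Finset.sum_congr rfl fun j hj => hE.eq_of_adj j i ((G.mem_neighborFinset i j).1 hj).symm]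
  simp [hd.degree_eq i]

omit [Nonempty V] in
-- The all-ones vector is an eigenvector for d, and d ≠ λ_min, so it is orthogonal to the columns of
-- E.
theorem sum_eq_zero (hE : G.IsEdgeConstantEigenmatrix e E) (hd : G.IsRegularOfDegree d)
    (h : G ≠ ⊥) (i : V) : ∑ j, E i j = 0 := by
  have hneg := minEigenvalue_neg h
  have h1 : ∑ k, (G.adjMatrix ℝ * E) k i = d * ∑ k, E k i := by
    simp only [mul_apply]
    rw [Finset.sum_comm, Finset.mul_sum]
    refine Finset.sum_congr rfl fun k _ => ?_
    rw [← Finset.sum_mul, ← hd.sum_adjMatrix k]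
    simp [adjMatrix_apply, adj_comm]
  rw [hE.mul_eq] at h1
  simp only [Matrix.smul_apply, smul_eq_mul, ← Finset.mul_sum] at h1
  have h2 : (d - G.minEigenvalue) * ∑ k, E k i = 0 := by linarith
  have h3 : (d - G.minEigenvalue) ≠ 0 := by
    have := Nat.cast_nonneg (α := ℝ) d
    linarith
  rw [← (mul_eq_zero.1 h2).resolve_left h3]
  exact Finset.sum_congr rfl fun j _ => (posSemidef_iff_sum.1 hE.posSemidef).1 _ _

theorem exists_isThetaDual (hE : G.IsEdgeConstantEigenmatrix e E) (hd : G.IsRegularOfDegree d)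
    (h : G ≠ ⊥) : ∃ (B : Matrix V V ℝ) (b s : ℝ), G.IsThetaDual B ∧ 0 < b ∧
      -(Fintype.card V * G.minEigenvalue) / (d - G.minEigenvalue) * b = s ∧
      (∀ i, B i i = b) ∧ ∀ i, ∑ j, B i j = s := by
  have hneg := minEigenvalue_neg h
  have hd0 := Nat.cast_nonneg (α := ℝ) d
  have hdm : 0 < d - G.minEigenvalue := by linarith
  -- Adding -eJ cancels the edge entries. The diagonal becomes e d / λ_min - e and the row sums -n
  -- e, whose quotient is Hoffman's value.
  refine ⟨E + (-e) • of fun _ _ => 1, e * (d - G.minEigenvalue) / G.minEigenvalue,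
    -(Fintype.card V * e), ⟨hE.posSemidef.add (PosSemidef.smul ?_ (by linarith [hE.neg])),
    fun i j h => ?_⟩, ?_, ?_, fun i => ?_, fun i => ?_⟩
  · convert posSemidef_of_sum_mul fun (_ : V) (_ : Unit) => (1 : ℝ) using 1
    ext
    simp
  · simp [hE.eq_of_adj i j h]
  · exact div_pos_of_neg_of_neg (mul_neg_of_neg_of_pos hE.neg hdm) hneg
  · have := hneg.ne
    field_simp
  · have h1 := hE.mul_diag_eq hd i
    have := hneg.ne
    simp only [Matrix.add_apply, Matrix.smul_apply, of_apply, smul_eq_mul]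
    field_simp
    linarith
  · simp [Finset.sum_add_distrib, hE.sum_eq_zero hd h]

theorem lovaszTheta_eq (hE : G.IsEdgeConstantEigenmatrix e E) (hd : G.IsRegularOfDegree d)
    (h : G ≠ ⊥) :
    G.lovaszTheta = -(Fintype.card V * G.minEigenvalue) / (d - G.minEigenvalue) := by
  refine (hd.lovaszTheta_le h).antisymm ?_
  obtain ⟨B, b, s, hB, hb, hs, hdiag, hrow⟩ := hE.exists_isThetaDual hd h
  have h1 := hB.sum_le
  have hn : (0 : ℝ) < Fintype.card V := by exact_mod_cast Fintype.card_pos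
  simp only [hrow, trace, diag_apply, hdiag, sum_const, card_univ, nsmul_eq_mul, ← hs] at h1
  refine le_of_mul_le_mul_right ?_ (mul_pos hn hb)
  linarith

theorem hasHomogeneousDual (hE : G.IsEdgeConstantEigenmatrix e E) (hd : G.IsRegularOfDegree d)
    (h : G ≠ ⊥) : G.HasHomogeneousDual := by
  intro t ht
  obtain ⟨B, b, s, hB, hb, hs, hdiag, hrow⟩ := hE.exists_isThetaDual hd h
  refine ⟨B, b, s, hB, hb, ?_, hdiag, hrow⟩
  rw [← hs]
  exact mul_le_mul_of_nonneg_right (ht.le.trans (hd.lovaszTheta_le h)) hb.le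

end IsEdgeConstantEigenmatrix

end Regular

/-! ### Homogeneous certificates from transitivity and strong regularity -/

instance finiteAut : Finite (G ≃g G) := DFunLike.finite _

theorem sum_aut_mul_right {V : Type*} {G : SimpleGraph V} [Fintype (G ≃g G)] (f : (G ≃g G) → ℝ) (τ : G ≃g G) :
    ∑ σ : G ≃g G, f (σ * τ) = ∑ σ : G ≃g G, f σ :=
  Equiv.sum_comp (Equiv.mulRight τ) f

/-- Summing the translates of v vᵀ, with v a least eigenvector, over all automorphisms gives an
invariant matrix; its symmetry handles automorphisms that reverse an edge. The edge value is
negative because λ_min E i i = d e with E i i > 0. -/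
theorem IsEdgeTransitive.exists_isEdgeConstantEigenmatrix {d : ℕ} (hG : G.IsEdgeTransitive)
    (hd : G.IsRegularOfDegree d) (h : G ≠ ⊥) : ∃ e E, G.IsEdgeConstantEigenmatrix e E := by
  have := Fintype.ofFinite (G ≃g G)
  obtain ⟨a, b, hab⟩ := ne_bot_iff_exists_adj.1 h
  have hneg := minEigenvalue_neg h
  obtain ⟨v, hv, hAv⟩ := exists_adjMatrix_mulVec_eq_minEigenvalue_smul G
  set E : Matrix V V ℝ := of fun i j => ∑ σ : G ≃g G, v (σ i) * v (σ j) with hE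
  have hsymm : ∀ i j, E i j = E j i := fun i j => by simp [hE, mul_comm]
  have hinv : ∀ (τ : G ≃g G) i j, E (τ i) (τ j) = E i j := fun τ i j =>
    sum_aut_mul_right (fun σ => v (σ i) * v (σ j)) τ
  have hconst : ∀ i j, G.Adj i j → E i j = E a b := by
    intro i j hij
    obtain ⟨τ, hτ⟩ := hG s(i, j) hij s(a, b) hab
    rw [Sym2.map_mk, Sym2.eq_iff] at hτ
    rw [← hinv τ]
    rcases hτ with ⟨h1, h2⟩ | ⟨h1, h2⟩
    · rw [← h1, ← h2]
    · rw [h1, h2, hsymm]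
  have hmul : G.adjMatrix ℝ * E = G.minEigenvalue • E := by
    ext i j
    rw [adjMatrix_mul_apply, Matrix.smul_apply, smul_eq_mul]
    simp only [hE, of_apply, Finset.mul_sum]
    rw [Finset.sum_comm]
    refine Finset.sum_congr rfl fun σ _ => ?_
    have h1 := congrFun hAv (σ i)
    rw [adjMatrix_mulVec_apply, Pi.smul_apply, smul_eq_mul] at h1
    rw [← Finset.sum_mul, ← mul_assoc, ← h1]
    congr 1
    refine Finset.sum_equiv σ.toEquiv (fun k => ?_) fun k _ => rfl
    simpa using σ.map_adj_iff.symm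
  refine ⟨E a b, E, posSemidef_of_sum_mul _, ?_, hmul, hconst⟩
  obtain ⟨i, hi⟩ := Function.ne_iff.1 hv
  have h1 : 0 < E i i := by
    refine Finset.sum_pos' (fun σ _ => mul_self_nonneg _) ⟨1, Finset.mem_univ _, ?_⟩
    exact mul_self_pos.2 hi
  have h2 : G.minEigenvalue * E i i = d * E a b := by
    have h := congrFun (congrFun hmul i) i
    rw [adjMatrix_mul_apply, Matrix.smul_apply, smul_eq_mul] at h
    rw [← h, Finset.sum_congr rfl fun j hj => hconst j i ((G.mem_neighborFinset i j).1 hj).symm]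
    simp [hd.degree_eq i]
  by_contra! h3
  have := mul_neg_of_neg_of_pos hneg h1
  have := mul_nonneg (Nat.cast_nonneg (α := ℝ) d) h3
  linarith

omit [DecidableEq V] [DecidableRel G.Adj] in
-- Averaging a near-optimal dual certificate over automorphisms keeps the ratio of entry sum to
-- trace, and transitivity makes diagonal and row sums constant.
theorem IsVertexTransitive.hasHomogeneousDual (hG : G.IsVertexTransitive) :
    G.HasHomogeneousDual := by
  classical
  have := Fintype.ofFinite (G ≃g G)
  intro t ht
  obtain ⟨B, hB, htr, hle⟩ := exists_isThetaDual_of_lt ht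
  set C : Matrix V V ℝ := ∑ σ : G ≃g G, B.submatrix σ σ with hC
  have hCa : ∀ i j, C i j = ∑ σ : G ≃g G, B (σ i) (σ j) := fun i j => by
    rw [hC, Matrix.sum_apply]
    rfl
  have hinv : ∀ (τ : G ≃g G) i j, C (τ i) (τ j) = C i j := fun τ i j => by
    rw [hCa, hCa]
    exact sum_aut_mul_right (fun σ => B (σ i) (σ j)) τ
  obtain ⟨o⟩ := ‹Nonempty V›
  have hdiag : ∀ i, C i i = C o o := fun i => by
    obtain ⟨τ, rfl⟩ := hG o i
    exact hinv τ o o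
  have hrow : ∀ i, ∑ j, C i j = ∑ j, C o j := fun i => by
    obtain ⟨τ, rfl⟩ := hG o i
    rw [← Equiv.sum_comp τ.toEquiv]
    exact Finset.sum_congr rfl fun j _ => hinv τ o j
  have hn : (0 : ℝ) < Fintype.card V := by exact_mod_cast Fintype.card_pos_iff.2 ⟨o⟩
  have hN : (0 : ℝ) < Fintype.card (G ≃g G) := by exact_mod_cast Fintype.card_pos_iff.2 ⟨1⟩
  have h1 : Fintype.card V * C o o = Fintype.card (G ≃g G) * B.trace := by
    have e1 : ∑ i, C i i = Fintype.card V * C o o := by simp [hdiag]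
    rw [← e1]
    simp only [hCa]
    rw [Finset.sum_comm, Finset.sum_congr rfl fun σ _ =>
      Equiv.sum_comp σ.toEquiv fun i => B i i]
    simp [trace]
  have h2 : Fintype.card V * ∑ j, C o j = Fintype.card (G ≃g G) * ∑ i, ∑ j, B i j := by
    have e1 : ∑ i, ∑ j, C i j = Fintype.card V * ∑ j, C o j := by simp [hrow]
    have e2 : ∀ σ : G ≃g G, ∑ i, ∑ j, B (σ i) (σ j) = ∑ i, ∑ j, B i j := fun σ => by
      rw [← Equiv.sum_comp σ.toEquiv fun i => ∑ j, B i j]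
      exact Finset.sum_congr rfl fun i _ => Equiv.sum_comp σ.toEquiv fun j => B (σ i) j
    rw [← e1]
    simp only [hCa]
    have e3 : ∑ i, ∑ j, ∑ σ : G ≃g G, B (σ i) (σ j)
        = ∑ σ : G ≃g G, ∑ i, ∑ j, B (σ i) (σ j) := by
      rw [Finset.sum_comm]
      simp_rw [Finset.sum_comm (s := (univ : Finset V)) (t := (univ : Finset (G ≃g G)))]
      refine Finset.sum_congr rfl fun σ _ => Finset.sum_comm
    rw [e3]
    simp [e2]
  refine ⟨C, C o o, ∑ j, C o j, ⟨posSemidef_sum _ fun σ _ => hB.posSemidef.submatrix σ,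
    fun i j hij => ?_⟩, ?_, ?_, hdiag, hrow⟩
  · rw [hCa]
    exact Finset.sum_eq_zero fun σ _ => hB.eq_zero _ _ (σ.map_adj_iff.2 hij)
  · exact pos_of_mul_pos_right (h1 ▸ mul_pos hN htr) hn.le
  · refine le_of_mul_le_mul_left ?_ hn
    rw [h2, mul_left_comm, h1, mul_left_comm]
    exact mul_le_mul_of_nonneg_left hle hN.le

omit [Nonempty V] in
-- In a complete graph the parameter m is unconstrained and can be reset to 0; otherwise it counts
-- common neighbours of an actual pair.
theorem IsStronglyRegular.exists_isSRGWith_le (hG : G.IsStronglyRegular) :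
    ∃ d l m : ℕ, G.IsSRGWith (Fintype.card V) d l m ∧ m ≤ d := by
  obtain ⟨d, l, m, h⟩ := hG
  by_cases hex : ∃ v w, v ≠ w ∧ ¬ G.Adj v w
  · obtain ⟨v, w, hne, hna⟩ := hex
    refine ⟨d, l, m, h, ?_⟩
    have h1 : Fintype.card (G.commonNeighbors v w) = m := h.of_not_adj hne hna
    rw [← h1, ← h.regular.degree_eq v]
    exact G.card_commonNeighbors_le_degree_left v w
  · push Not at hex
    exact ⟨d, l, 0, ⟨h.card, h.regular, h.of_adj, fun v w hne hna => absurd (hex v w hne) hna⟩,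
      Nat.zero_le d⟩

/-- On vectors of sum zero A satisfies a quadratic with roots x = λ_min and r. Hence rI - A,
corrected by a multiple of J, is r - x times an orthogonal projection into the x-eigenspace, and its
entries at edges agree. -/
theorem IsSRGWith.exists_isEdgeConstantEigenmatrix {d l m : ℕ}
    (hG : G.IsSRGWith (Fintype.card V) d l m) (hmd : m ≤ d) (h : G ≠ ⊥) :
    ∃ e E, G.IsEdgeConstantEigenmatrix e E := by
  have hneg := minEigenvalue_neg h
  obtain ⟨v, hv, hAv⟩ := exists_adjMatrix_mulVec_eq_minEigenvalue_smul G
  set A := G.adjMatrix ℝ with hA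
  set x := G.minEigenvalue with hx
  set J : Matrix V V ℝ := of fun _ _ => 1 with hJ
  have hd0 := Nat.cast_nonneg (α := ℝ) d
  have hn : (0 : ℝ) < Fintype.card V := by exact_mod_cast Fintype.card_pos
  set n : ℝ := (Fintype.card V : ℝ) with hn'
  have hsq : A * A = ((d : ℝ) - m) • (1 : Matrix V V ℝ) + ((l : ℝ) - m) • A + (m : ℝ) • J := by
    have h1 := hG.matrix_eq (α := ℝ)
    have h2 : Gᶜ.adjMatrix ℝ = J - 1 - A := by
      ext i j
      rcases eq_or_ne i j with rfl | hij
      · simp [hA, hJ]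
      · by_cases hadj : G.Adj i j <;> simp [hA, hJ, hij, hadj]
    rw [← sq, h1, h2]
    simp only [← Nat.cast_smul_eq_nsmul ℝ]
    module
  have hAJ : A * J = (d : ℝ) • J := by
    ext i j
    simp only [hJ, mul_apply, of_apply, mul_one, hA, hG.regular.sum_adjMatrix, Matrix.smul_apply,
      smul_eq_mul]
  have hJA : J * A = (d : ℝ) • J := by
    have := congrArg transpose hAJ
    rwa [transpose_mul, transpose_smul, hA, transpose_adjMatrix,
      show Jᵀ = J from rfl] at this
  have hJJ : J * J = n • J := by
    ext i j
    simp [hJ, mul_apply, hn']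
  have hJv : J *ᵥ v = 0 := by
    have h1 : (d - x) • (J *ᵥ v) = 0 := by
      rw [sub_smul, ← mulVec_smul (b := x), ← hAv, mulVec_mulVec, hJA, smul_mulVec, sub_self]
    exact (smul_eq_zero.1 h1).resolve_left (by linarith)
  have hquad : x * x = (d - m) + (l - m) * x := by
    have h1 : (A * A) *ᵥ v = (x * x) • v := by
      rw [← mulVec_mulVec, hAv, mulVec_smul, hAv, smul_smul]
    rw [hsq, add_mulVec, add_mulVec, smul_mulVec, smul_mulVec, smul_mulVec, hJv, one_mulVec,
      hAv, smul_zero, add_zero, smul_smul, ← add_smul] at h1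
    exact (smul_left_injective ℝ hv h1).symm
  set r : ℝ := l - m - x with hr
  have hxr : x * r = m - d := by rw [hr]; linarith
  have hmd' : (m : ℝ) ≤ d := by exact_mod_cast hmd
  have hr0 : 0 ≤ r := by
    by_contra! hr1
    have := mul_pos_of_neg_of_neg hneg hr1
    linarith
  -- Multiply the quadratic relation by J and compare entries.
  have hmn : (d - r) * (d - x) = m * n := by
    have h1 : (A * A) * J = ((d : ℝ) * d) • J := by
      rw [mul_assoc, hAJ, mul_smul_comm, hAJ, smul_smul]
    rw [hsq, add_mul, add_mul, smul_mul_assoc, smul_mul_assoc, smul_mul_assoc, one_mul, hAJ, hJJ,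
      smul_smul, smul_smul, ← add_smul, ← add_smul] at h1
    obtain ⟨o⟩ := ‹Nonempty V›
    have h2 := congrFun (congrFun h1 o) o
    simp only [hJ, Matrix.smul_apply, of_apply, smul_eq_mul, mul_one] at h2
    have : (d - r) * (d - x) = d * d - d * (l - m) + x * r := by rw [hr]; ring
    rw [this, hxr]
    linarith
  -- The value of c for which JE = (r - d + c n)J vanishes.
  set c : ℝ := (d - r) / n with hc
  have hcn : c * n = d - r := by rw [hc]; field_simp
  set E : Matrix V V ℝ := r • 1 - A + c • J with hE
  have hmul : A * E = x • E := by
    have h1 : c * d - m = x * c := by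
      have : c * (d - x) * n = m * n := by rw [← hmn, ← hcn]; ring
      have := mul_right_cancel₀ hn.ne' this
      linarith
    have h2 : A * E = (-(d - m : ℝ)) • 1 + (r - (l - m)) • A + (c * d - m) • J := by
      rw [hE, mul_add, mul_sub, hsq, mul_smul_comm, mul_one, mul_smul_comm, hAJ]
      module
    rw [h2, h1, hE, show -(d - m : ℝ) = x * r by linarith, show r - (l - m) = -x by rw [hr]; ring]
    module
  have hJE : J * E = 0 := by
    rw [hE, mul_add, mul_sub, mul_smul_comm, mul_one, hJA, mul_smul_comm, hJJ, smul_smul, hcn]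
    module
  have hEE : E * E = (r - x) • E := by
    conv_lhs => rw [hE]
    rw [← hE, add_mul, sub_mul, smul_mul_assoc, one_mul, hmul, smul_mul_assoc, hJE]
    module
  have hET : Eᴴ = E := by
    rw [conjTranspose_eq_transpose_of_trivial, hE, transpose_add, transpose_sub, transpose_smul,
      transpose_one, transpose_smul, hA, transpose_adjMatrix]
    rfl
  have hrx : 0 < r - x := by linarith
  refine ⟨-1 + c, E, ?_, ?_, hmul, fun i j hij => ?_⟩
  · have h1 := (posSemidef_conjTranspose_mul_self E).smul (inv_pos.2 hrx).le
    rwa [hET, hEE, smul_smul, inv_mul_cancel₀ hrx.ne', one_smul] at h1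
  · have h1 : (d : ℝ) < n := by
      obtain ⟨o⟩ := ‹Nonempty V›
      rw [hn', ← hG.regular.degree_eq o]
      exact_mod_cast G.degree_lt_card_verts o
    have h2 : c < 1 := by
      rw [hc, div_lt_one hn]
      linarith
    linarith
  · simp [hE, hA, hJ, hij, hij.ne]

theorem isVertexTransitive_bot {V : Type*} [DecidableEq V] : (⊥ : SimpleGraph V).IsVertexTransitive := fun u v =>
  ⟨⟨Equiv.swap u v, by simp⟩, Equiv.swap_apply_left u v⟩

theorem hasHomogeneousDual_of_isVertexTransitive_or_isStronglyRegular
    (hG : G.IsVertexTransitive ∨ G.IsStronglyRegular) : G.HasHomogeneousDual := by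
  rcases hG with hG | hG
  · exact hG.hasHomogeneousDual
  -- An edgeless graph has no negative eigenvalue, so the eigenmatrix argument fails; but it is
  -- vertex-transitive.
  · rcases eq_or_ne G ⊥ with h | h
    · refine IsVertexTransitive.hasHomogeneousDual ?_
      rw [h]
      exact isVertexTransitive_bot
    · obtain ⟨d, l, m, hs, hmd⟩ := hG.exists_isSRGWith_le
      obtain ⟨e, E, hE⟩ := hs.exists_isEdgeConstantEigenmatrix hmd h
      exact hE.hasHomogeneousDual hs.regular h

theorem IsRegularOfDegree.lovaszTheta_eq {d : ℕ} (hd : G.IsRegularOfDegree d) (h : G ≠ ⊥)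
    (hG : G.IsEdgeTransitive ∨ G.IsStronglyRegular) :
    G.lovaszTheta = -(Fintype.card V * G.minEigenvalue) / (d - G.minEigenvalue) := by
  rcases hG with hG | hG
  · obtain ⟨e, E, hE⟩ := hG.exists_isEdgeConstantEigenmatrix hd h
    exact hE.lovaszTheta_eq hd h
  · obtain ⟨d', l, m, hs, hmd⟩ := hG.exists_isSRGWith_le
    obtain ⟨e, E, hE⟩ := hs.exists_isEdgeConstantEigenmatrix hmd h
    exact hE.lovaszTheta_eq hd h

end SimpleGraph

/-! ### Valency of the product and the ratios n / θ -/

namespace SimpleGraph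

theorem IsRegularOfDegree.strongProductFamily {κ : Type*} [Fintype κ] {V : κ → Type*}
    [∀ l, Fintype (V l)] [∀ l, DecidableEq (V l)] {G : ∀ l, SimpleGraph (V l)}
    [∀ l, DecidableRel (G l).Adj] [DecidableEq κ] {d : κ → ℕ}
    (hd : ∀ l, (G l).IsRegularOfDegree (d l)) :
    (SimpleGraph.strongProductFamily G).IsRegularOfDegree (∏ l, (1 + d l) - 1) := by
  intro x
  -- Closed neighbourhoods multiply; the final -1 removes the vertex itself.
  have h1 : insert x ((SimpleGraph.strongProductFamily G).neighborFinset x)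
      = Fintype.piFinset fun l => insert (x l) ((G l).neighborFinset (x l)) := by
    ext y
    simp only [mem_insert, mem_neighborFinset, Fintype.mem_piFinset]
    constructor
    · rintro (rfl | h) l
      · exact Or.inl rfl
      · exact (h.2 l).imp Eq.symm id
    · intro h
      rcases eq_or_ne y x with hy | hy
      · exact Or.inl hy
      · exact Or.inr ⟨hy.symm, fun l => (h l).imp Eq.symm id⟩
  have h2 := congrArg Finset.card h1
  rw [Fintype.card_piFinset, card_insert_of_notMem (by simp)] at h2
  have h3 : ∀ l, (insert (x l) ((G l).neighborFinset (x l))).card = 1 + d l := fun l => by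
    rw [card_insert_of_notMem (by simp), card_neighborFinset_eq_degree, (hd l).degree_eq, add_comm]
  simp only [h3] at h2
  rw [← h2, card_neighborFinset_eq_degree, Nat.add_sub_cancel]

theorem strongProductFamily_ne_bot {κ : Type*} [Nonempty κ] {V : κ → Type*} [∀ l, Nonempty (V l)]
    {G : ∀ l, SimpleGraph (V l)} (h : ∀ l, G l ≠ ⊥) : strongProductFamily G ≠ ⊥ := by
  choose a b hab using fun l => ne_bot_iff_exists_adj.1 (h l)
  refine ne_bot_iff_exists_adj.2 ⟨a, b, fun h => ?_, fun l => Or.inr (hab l)⟩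
  obtain ⟨l⟩ := ‹Nonempty κ›
  exact (hab l).ne (congrFun h l)

theorem prod_card_div_lovaszTheta {κ : Type*} [Fintype κ] [DecidableEq κ] {V : κ → Type*}
    [∀ l, Fintype (V l)] [∀ l, Nonempty (V l)] (G : ∀ l, SimpleGraph (V l)) :
    ∏ l, (Fintype.card (V l) : ℝ) / (G l).lovaszTheta
      = Fintype.card (∀ l, V l) / (strongProductFamily G).lovaszTheta := by
  rw [lovaszTheta_strongProductFamily, Finset.prod_div_distrib, Fintype.card_pi, Nat.cast_prod]

section Ratio

variable {V : Type*} [Fintype V] [DecidableEq V] {G : SimpleGraph V} [DecidableRel G.Adj] {d : ℕ}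

theorem one_sub_div_minEigenvalue_pos (h : G ≠ ⊥) : 0 < 1 - d / G.minEigenvalue := by
  have := div_nonpos_of_nonneg_of_nonpos (Nat.cast_nonneg (α := ℝ) d) (minEigenvalue_neg h).le
  linarith

theorem card_div_hoffman [Nonempty V] (h : G ≠ ⊥) :
    Fintype.card V / (-(Fintype.card V * G.minEigenvalue) / (d - G.minEigenvalue))
      = 1 - d / G.minEigenvalue := by
  have hneg := minEigenvalue_neg h
  have hn : (0 : ℝ) < Fintype.card V := by exact_mod_cast Fintype.card_pos
  have h1 : (d : ℝ) - G.minEigenvalue ≠ 0 := by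
    have := Nat.cast_nonneg (α := ℝ) d
    linarith
  have h2 := hneg.ne
  field_simp
  ring

variable [Nonempty V]

theorem IsRegularOfDegree.one_sub_div_le (hd : G.IsRegularOfDegree d) (h : G ≠ ⊥) :
    1 - d / G.minEigenvalue ≤ Fintype.card V / G.lovaszTheta := by
  rw [← card_div_hoffman h]
  exact div_le_div_of_nonneg_left (Nat.cast_nonneg _) lovaszTheta_pos (hd.lovaszTheta_le h)

theorem IsRegularOfDegree.card_div_lovaszTheta (hd : G.IsRegularOfDegree d) (h : G ≠ ⊥)
    (hG : G.IsEdgeTransitive ∨ G.IsStronglyRegular) :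
    Fintype.card V / G.lovaszTheta = 1 - d / G.minEigenvalue := by
  rw [hd.lovaszTheta_eq h hG, card_div_hoffman h]

/-- Both steps pass through the complement: θ(G) ω(G) ≤ θ(G) θ(Gᶜ) ≤ n. -/
theorem cliqueNum_le_card_div_lovaszTheta (hG : G.IsVertexTransitive ∨ G.IsStronglyRegular) :
    (G.cliqueNum : ℝ) ≤ Fintype.card V / G.lovaszTheta := by
  rw [le_div_iff₀' lovaszTheta_pos]
  exact (mul_le_mul_of_nonneg_left cliqueNum_le_lovaszTheta_compl lovaszTheta_pos.le).trans
    (hasHomogeneousDual_of_isVertexTransitive_or_isStronglyRegular hG).mul_le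

theorem IsSelfComplementary.lovaszTheta_eq_sqrt (hs : G.IsSelfComplementary)
    (hG : G.IsVertexTransitive ∨ G.IsStronglyRegular) :
    G.lovaszTheta = √(Fintype.card V) := by
  have h1 := card_le_lovaszTheta_mul_lovaszTheta_compl (G := G)
  have h2 := (hasHomogeneousDual_of_isVertexTransitive_or_isStronglyRegular hG).mul_le
  rw [hs.lovaszTheta_compl] at h1 h2
  rw [h1.antisymm h2, Real.sqrt_mul_self lovaszTheta_pos.le]

end Ratio

end SimpleGraph

end LovaszTheta

/-! ### Assembly of parts (a)–(f) -/

theorem mainTheorem7 {k : ℕ} (hk : 1 ≤ k) {V : Fin k → Type*} [∀ l, Fintype (V l)]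
    [∀ l, Nonempty (V l)] [∀ l, DecidableEq (V l)]
    (G : ∀ l, SimpleGraph (V l)) [∀ l, DecidableRel (G l).Adj] :
    ((⌈∏ l, (Fintype.card (V l) : ℝ) / (G l).lovaszTheta⌉₊ : ℕ∞) ≤
        (SimpleGraph.strongProductFamily G).chromaticNumber ∧
      (⌈∏ l, (G l).lovaszTheta⌉₊ : ℕ∞) ≤
        (SimpleGraph.strongProductFamily G)ᶜ.chromaticNumber) ∧
    (∀ d : Fin k → ℕ, (∀ l, (G l).IsRegularOfDegree (d l)) →
      (⌈∏ l, (Fintype.card (V l) : ℝ) / (G l).lovaszTheta⌉₊ : ℕ∞) ≤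
        (SimpleGraph.strongProductFamily G).chromaticNumber ∧
      ((∀ l, G l ≠ ⊥) →
        ⌈∏ l, (1 - (d l : ℝ) / (G l).minEigenvalue)⌉₊ ≤
          ⌈∏ l, (Fintype.card (V l) : ℝ) / (G l).lovaszTheta⌉₊ ∧
        ((∀ l, (G l).IsEdgeTransitive ∨ (G l).IsStronglyRegular) →
          ⌈∏ l, (Fintype.card (V l) : ℝ) / (G l).lovaszTheta⌉₊ =
            ⌈∏ l, (1 - (d l : ℝ) / (G l).minEigenvalue)⌉₊))) ∧
    (∀ d : Fin k → ℕ, (∀ l, (G l).IsRegularOfDegree (d l)) → (∀ l, G l ≠ ⊥) →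
      (∀ l, (G l).IsEdgeTransitive ∨ (G l).IsStronglyRegular) →
      (SimpleGraph.strongProductFamily G).IsRegularOfDegree (∏ l, (1 + d l) - 1) ∧
      1 - ((∏ l, (1 + (d l : ℝ))) - 1) / (SimpleGraph.strongProductFamily G).minEigenvalue ≤
        ∏ l, (1 - (d l : ℝ) / (G l).minEigenvalue)) ∧
    ((∀ l, (G l).IsVertexTransitive ∨ (G l).IsStronglyRegular) →
      ∏ l, (G l).cliqueNum ≤ ⌈∏ l, (Fintype.card (V l) : ℝ) / (G l).lovaszTheta⌉₊) ∧
    (∀ d : Fin k → ℕ, (∀ l, (G l).IsRegularOfDegree (d l)) → (∀ l, G l ≠ ⊥) →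
      (∀ l, ((G l).IsVertexTransitive ∧ (G l).IsEdgeTransitive) ∨ (G l).IsStronglyRegular) →
      ∏ l, (G l).cliqueNum ≤ ⌈∏ l, (1 - (d l : ℝ) / (G l).minEigenvalue)⌉₊) ∧
    (∀ d : Fin k → ℕ, (∀ l, (G l).IsRegularOfDegree (d l)) → (∀ l, G l ≠ ⊥) →
      (∀ l, (G l).IsEdgeTransitive ∨ (G l).IsStronglyRegular) →
      (⌈∏ l, (-((Fintype.card (V l) : ℝ) * (G l).minEigenvalue) /
          ((d l : ℝ) - (G l).minEigenvalue))⌉₊ : ℕ∞) ≤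
        (SimpleGraph.strongProductFamily G)ᶜ.chromaticNumber) ∧
    ((∀ l, (G l).IsSelfComplementary) →
      (∀ l, (G l).IsVertexTransitive ∨ (G l).IsStronglyRegular) →
      (⌈Real.sqrt (∏ l, (Fintype.card (V l) : ℝ))⌉₊ : ℕ∞) ≤
        (SimpleGraph.strongProductFamily G).chromaticNumber ∧
      (⌈Real.sqrt (∏ l, (Fintype.card (V l) : ℝ))⌉₊ : ℕ∞) ≤
        (SimpleGraph.strongProductFamily G)ᶜ.chromaticNumber) := by
  have ha₁ : (⌈∏ l, (Fintype.card (V l) : ℝ) / (G l).lovaszTheta⌉₊ : ℕ∞) ≤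
      (SimpleGraph.strongProductFamily G).chromaticNumber := by
    rw [SimpleGraph.prod_card_div_lovaszTheta]
    exact SimpleGraph.natCeil_le_chromaticNumber fun m hm =>
      SimpleGraph.card_div_lovaszTheta_le_of_colorable hm
  have ha₂ : (⌈∏ l, (G l).lovaszTheta⌉₊ : ℕ∞) ≤
      (SimpleGraph.strongProductFamily G)ᶜ.chromaticNumber := by
    rw [← SimpleGraph.lovaszTheta_strongProductFamily]
    exact SimpleGraph.natCeil_le_chromaticNumber fun m hm =>
      SimpleGraph.lovaszTheta_le_of_colorable_compl hm
  have hratio : ∀ d : Fin k → ℕ, (∀ l, (G l).IsRegularOfDegree (d l)) → (∀ l, G l ≠ ⊥) →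
      (∀ l, (G l).IsEdgeTransitive ∨ (G l).IsStronglyRegular) →
      ∏ l, (Fintype.card (V l) : ℝ) / (G l).lovaszTheta =
        ∏ l, (1 - (d l : ℝ) / (G l).minEigenvalue) := fun d hd hne hG =>
    Finset.prod_congr rfl fun l _ => (hd l).card_div_lovaszTheta (hne l) (hG l)
  have hclique : (∀ l, (G l).IsVertexTransitive ∨ (G l).IsStronglyRegular) →
      ∏ l, (G l).cliqueNum ≤ ⌈∏ l, (Fintype.card (V l) : ℝ) / (G l).lovaszTheta⌉₊ := by
    intro hG
    rw [← Nat.cast_le (α := ℝ), Nat.cast_prod]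
    exact (Finset.prod_le_prod (fun l _ => Nat.cast_nonneg _) fun l _ =>
      SimpleGraph.cliqueNum_le_card_div_lovaszTheta (hG l)).trans (Nat.le_ceil _)
  refine ⟨⟨ha₁, ha₂⟩, fun d hd => ⟨ha₁, fun hne => ⟨?_, fun hG => ?_⟩⟩, fun d hd hne hG => ⟨?_, ?_⟩,
    hclique, fun d hd hne hG => ?_, fun d hd hne hG => ?_, fun hs hG => ?_⟩
  · exact Nat.ceil_mono (Finset.prod_le_prod
      (fun l _ => (SimpleGraph.one_sub_div_minEigenvalue_pos (hne l)).le)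
      fun l _ => (hd l).one_sub_div_le (hne l))
  · rw [hratio d hd hne hG]
  · exact SimpleGraph.IsRegularOfDegree.strongProductFamily hd
  -- An empty product would have no edge; with k ≥ 1 Hoffman's bound applies to the product graph.
  · have : Nonempty (Fin k) := ⟨⟨0, hk⟩⟩
    have h := (SimpleGraph.IsRegularOfDegree.strongProductFamily hd).one_sub_div_le
      (SimpleGraph.strongProductFamily_ne_bot hne)
    -- The truncated subtraction in the valency is a true one.
    have h1 : 1 ≤ ∏ l, (1 + d l) := Finset.prod_pos fun l _ => Nat.add_pos_left one_pos _
    rw [← SimpleGraph.prod_card_div_lovaszTheta, hratio d hd hne hG, Nat.cast_sub h1] at h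
    push_cast at h
    exact h
  · rw [← hratio d hd hne fun l => (hG l).imp And.right id]
    exact hclique fun l => (hG l).imp And.left id
  · rw [← Finset.prod_congr rfl fun l _ => (hd l).lovaszTheta_eq (hne l) (hG l)]
    exact ha₂
  · have h : ∀ l, (G l).lovaszTheta = √(Fintype.card (V l)) := fun l =>
      (hs l).lovaszTheta_eq_sqrt (hG l)
    have h1 : √(∏ l, (Fintype.card (V l) : ℝ)) = ∏ l, √(Fintype.card (V l)) :=
      Real.sqrt_prod _ fun l _ => Nat.cast_nonneg _
    rw [h1]
    -- Since n / √n = √n, both bounds of (a) become the same product.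
    simp only [h, Real.div_sqrt] at ha₁ ha₂
    exact ⟨ha₁, ha₂⟩
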